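/- Let $d\ge 1$, let $Q$ be a real symmetric positive definite $d\times d$ matrix and let $B$ be a real $d\times d$ matrix all of whose (complex) eigenvalues have negative real part. For $0\le t\le\infty$ put $Q_t=\int_0^t e^{sB}Qe^{sB^*}\,ds$ and let $\gamma_t$ be the centred Gaussian measure on $\mathbb R^d$ with covariance matrix $Q_t$ (so $\gamma_0$ is the Dirac mass at $0$). The Ornstein–Uhlenbeck semigroup on $L^2(\gamma_\infty)$ is $$\mathcal H_t f(x)=\int_{\mathbb R^d} f(e^{tB}x-y)\,d\gamma_t(y),\qquad t\ge 0.$$ Let $M_1$ be an invertible real matrix with $M_1QM_1^*=I$, and let $M_2$ be a real orthogonal matrix such that $M_2M_1Q_\infty M_1^*M_2^*=D_\lambda:=\operatorname{diag}(\lambda_1,\dots,\lambda_d)$ with all $\lambda_j>0$. Put $M=M_2M_1$ and $\tilde B=MBM^{-1}$, and define the matrix $R$ by $$\tilde B=-\tfrac12 D_{1/\lambda}+R,\qquad D_{1/\lambda}=\operatorname{diag}(1/\lambda_1,\dots,1/\lambda_d).$$ Correspondingly the transformed generator $\mathcal L_{I,\tilde B}=\tfrac12\Delta+\langle \tilde Bx,\nabla\rangle$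 is the sum $\mathcal L^0+\mathcal R$ of the operators $$\mathcal L^0=\tfrac12\Delta-\tfrac12\langle D_{1/\lambda}x,\nabla\rangle,\qquad \mathcal R=\langle Rx,\nabla\rangle,$$ called its symmetric and antisymmetric parts. Then the following are equivalent, for real-valued as well as for complex-valued functions: (i) the semigroup $(\mathcal H_t)_{t\ge0}$ is normal on $L^2(\gamma_\infty)$, i.e. every $\mathcal H_t$, $t\ge0$, is a bounded operator on $L^2(\gamma_\infty)$ that commutes with its adjoint; (ii) $[\mathcal L^0,\mathcal R]\varphi=\mathcal L^0\mathcal R\varphi-\mathcal R\mathcal L^0\varphi=0$ for every Schwartz function $\varphi$ on $\mathbb R^d$; (iii) $R+R^*=0$; (iv) $D_\lambda R=RD_\lambda$. -/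

import Mathlib

open MeasureTheory ProbabilityTheory
open scoped Matrix SchwartzMap Laplacian

namespace OrnsteinUhlenbeck

/-- The matrix exponential `e^{sB}` of a real square matrix. -/
noncomputable def expMat {d : ℕ} (B : Matrix (Fin d) (Fin d) ℝ) (s : ℝ) :
    Matrix (Fin d) (Fin d) ℝ :=
  NormedSpace.exp (s • B)

/-- The entrywise integral of `e^{sB} Q e^{sB*}` over a set of times `S`. -/
noncomputable def covOver {d : ℕ} (Q B : Matrix (Fin d) (Fin d) ℝ) (S : Set ℝ) :
    Matrix (Fin d) (Fin d) ℝ :=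
  Matrix.of fun i j => ∫ s in S, (expMat B s * Q * expMat Bᵀ s) i j

/-- The covariance `Q_t = ∫_0^t e^{sB} Q e^{sB*} ds` for finite `t ≥ 0`. -/
noncomputable def covQ {d : ℕ} (Q B : Matrix (Fin d) (Fin d) ℝ) (t : ℝ) :
    Matrix (Fin d) (Fin d) ℝ :=
  covOver Q B (Set.Ioc 0 t)

/-- The covariance `Q_∞ = ∫_0^∞ e^{sB} Q e^{sB*} ds`. -/
noncomputable def covQInf {d : ℕ} (Q B : Matrix (Fin d) (Fin d) ℝ) :
    Matrix (Fin d) (Fin d) ℝ :=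
  covOver Q B (Set.Ioi 0)

/-- The centred Gaussian measure `γ_t` on `ℝ^d` with covariance `Q_t`.
At `t = 0` it is the Dirac mass at the origin, since `Q_0 = 0`. -/
noncomputable def gammaT {d : ℕ} (Q B : Matrix (Fin d) (Fin d) ℝ) (t : ℝ) :
    Measure (EuclideanSpace ℝ (Fin d)) :=
  multivariateGaussian 0 (covQ Q B t)

/-- The centred Gaussian measure `γ_∞` on `ℝ^d` with covariance `Q_∞`. -/
noncomputable def gammaInf {d : ℕ} (Q B : Matrix (Fin d) (Fin d) ℝ) :
    Measure (EuclideanSpace ℝ (Fin d)) :=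
  multivariateGaussian 0 (covQInf Q B)

/-- The Ornstein–Uhlenbeck formula `H_t f(x) = ∫ f(e^{tB} x - y) dγ_t(y)`. -/
noncomputable def ouApply {d : ℕ} {𝕜 : Type*} [RCLike 𝕜] (Q B : Matrix (Fin d) (Fin d) ℝ) (t : ℝ)
    (f : EuclideanSpace ℝ (Fin d) → 𝕜) (x : EuclideanSpace ℝ (Fin d)) : 𝕜 :=
  ∫ y, f (Matrix.toEuclideanCLM (𝕜 := ℝ) (expMat B t) x - y) ∂(gammaT Q B t)

/-- The bounded operator `T` on `L²(γ_∞)` is the operator `H_t` of the Ornstein–Uhlenbeck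
semigroup: it is given by the Ornstein–Uhlenbeck formula on every `f ∈ L²(γ_∞)`.
This determines `T` uniquely. -/
def IsOUOperator {d : ℕ} {𝕜 : Type*} [RCLike 𝕜] (Q B : Matrix (Fin d) (Fin d) ℝ) (t : ℝ)
    (T : Lp 𝕜 2 (gammaInf Q B) →L[𝕜] Lp 𝕜 2 (gammaInf Q B)) : Prop :=
  ∀ f : Lp 𝕜 2 (gammaInf Q B), ⇑(T f) =ᵐ[gammaInf Q B] ouApply Q B t ⇑f

/-- The Ornstein–Uhlenbeck semigroup is normal on `L²(γ_∞)`: every `H_t`, `t ≥ 0`, is a bounded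
operator on `L²(γ_∞)` that commutes with its Hilbert space adjoint. -/
def IsNormalSemigroup (𝕜 : Type*) [RCLike 𝕜] {d : ℕ} (Q B : Matrix (Fin d) (Fin d) ℝ) : Prop :=
  ∀ t : ℝ, 0 ≤ t → ∃ T : Lp 𝕜 2 (gammaInf Q B) →L[𝕜] Lp 𝕜 2 (gammaInf Q B),
    IsOUOperator Q B t T ∧ T * ContinuousLinearMap.adjoint T = ContinuousLinearMap.adjoint T * T

/-- The first order operator `⟨Ax, ∇⟩`. -/
noncomputable def drift {d : ℕ} {𝕜 : Type*} [RCLike 𝕜] (A : Matrix (Fin d) (Fin d) ℝ)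
    (f : EuclideanSpace ℝ (Fin d) → 𝕜) (x : EuclideanSpace ℝ (Fin d)) : 𝕜 :=
  fderiv ℝ f x (Matrix.toEuclideanCLM (𝕜 := ℝ) A x)

/-- The operator `L_{I,A} = ½ Δ + ⟨Ax, ∇⟩`, the Ornstein–Uhlenbeck generator with covariance `I`
and drift `A`. -/
noncomputable def generator {d : ℕ} {𝕜 : Type*} [RCLike 𝕜] (A : Matrix (Fin d) (Fin d) ℝ)
    (f : EuclideanSpace ℝ (Fin d) → 𝕜) (x : EuclideanSpace ℝ (Fin d)) : 𝕜 :=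
  (1 / 2 : ℝ) • Δ f x + drift A f x

/-- The symmetric part `L⁰ = ½ Δ - ½ ⟨D_{1/λ} x, ∇⟩`, where `D_{1/λ} = diag(1/λ_1, …, 1/λ_d)`. -/
noncomputable def symmPart {d : ℕ} {𝕜 : Type*} [RCLike 𝕜] (lam : Fin d → ℝ)
    (f : EuclideanSpace ℝ (Fin d) → 𝕜) (x : EuclideanSpace ℝ (Fin d)) : 𝕜 :=
  (1 / 2 : ℝ) • Δ f x - (1 / 2 : ℝ) • drift (Matrix.diagonal fun i => 1 / lam i) f x

/-- The antisymmetric part `ℛ = ⟨Rx, ∇⟩`. -/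
noncomputable def antisymmPart {d : ℕ} {𝕜 : Type*} [RCLike 𝕜] (R : Matrix (Fin d) (Fin d) ℝ)
    (f : EuclideanSpace ℝ (Fin d) → 𝕜) (x : EuclideanSpace ℝ (Fin d)) : 𝕜 :=
  drift R f x

/-- With `B̃ = -½ D_{1/λ} + R`, the generator splits as `L_{I,B̃} = L⁰ + ℛ`. -/
theorem generator_eq_symmPart_add_antisymmPart {d : ℕ} {𝕜 : Type*} [RCLike 𝕜] (lam : Fin d → ℝ)
    (R : Matrix (Fin d) (Fin d) ℝ) (f : EuclideanSpace ℝ (Fin d) → 𝕜)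
    (x : EuclideanSpace ℝ (Fin d)) :
    generator (-((1 / 2 : ℝ) • Matrix.diagonal fun i => 1 / lam i) + R) f x =
      symmPart lam f x + antisymmPart R f x := by
  simp only [generator, symmPart, antisymmPart, drift, map_add, map_neg, map_smul,
    add_apply, neg_apply, smul_apply]
  abel

end OrnsteinUhlenbeck

/-!
The four conditions are compared through matrices. Write `P = Q_∞`, `C = e^{tB}`, `D = D_λ`.

*The matrix side.* Since the spectrum of `B` lies in the left half plane, `e^{sB}` decays
exponentially, so `P` is given by a convergent integral and satisfies the Lyapunov equation
`B P + P B* = -Q` (`lyapunov`) as well as `P = Q_t + C P C*` (`covQInf_eq_covQ_add`). In the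
coordinates given by `M` the Lyapunov equation reads `R D + D R* = 0`, from which `R + R* = 0` is
equivalent to `D R = R D` (`add_transpose_eq_zero_iff_commute`).

*The commutator.* Differentiating, `[L⁰, ℛ] φ` is `∑ R_{ji} ∂_j ∂_i φ` plus a first order term with
coefficient matrix proportional to `[R, D_{1/λ}]` (`commutator_apply`). Testing at the origin on
Schwartz functions equal to `x_p x_q` near `0` gives `R + R* = 0`; conversely `R + R* = 0` kills the
second order term and, by the above, the first order one (`commutator_eq_zero_iff`).

*The semigroup.* The identity `P = Q_t + C P C*` says that `(x, y) ↦ C x - y` maps `γ_∞ × γ_t` to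
`γ_∞`. Hence `f ↦ f (C x - y)` is an isometry of `L²(γ_∞)` into `L²(γ_∞ × γ_t)`, and `H_t` is this
isometry followed by the adjoint of the embedding `g ↦ g(x)` (`transitionOp`); in particular it is
bounded. On the normalized exponentials `E_ξ(x) = exp (⟪ξ, x⟫ - ⟪ξ, P ξ⟫ / 2)`, for which
`⟪E_ξ, E_η⟫ = exp ⟪ξ, P η⟫`, it acts by `H_t E_ξ = E_{C* ξ}` and `H_t* E_ξ = E_{P⁻¹ C P ξ}`. The
`E_ξ` are total in `L²(γ_∞)` (`coherent_total`), over `ℝ` as well as over `ℂ`, and `ξ ↦ E_ξ` is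
injective, so `H_t` is normal if and only if `e^{tB*}` commutes with `e^{t P⁻¹ B P}`
(`isNormalSemigroup_iff`). For all `t ≥ 0` together this means that `B*` commutes with `P⁻¹ B P`
(`forall_commute_expMat_iff`), which in the coordinates given by `M` is the relation `D R = R D`
(`commute_transpose_conj_iff`).
-/

namespace OrnsteinUhlenbeck

open Filter Asymptotics
open scoped InnerProductSpace ContDiff

/-! ### Decay of the matrix exponential -/

/-- A function on `ℝ` that decays exponentially at `+∞`, at some unspecified rate. -/
def ExpDecay {F : Type*} [NormedAddCommGroup F] (u : ℝ → F) : Prop :=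
  ∃ c : ℝ, 0 < c ∧ u =O[atTop] fun s => Real.exp (-c * s)

lemma isBigO_exp_neg_mul {b c : ℝ} (h : b ≤ c) :
    (fun s : ℝ => Real.exp (-c * s)) =O[atTop] fun s => Real.exp (-b * s) := by
  refine IsBigO.of_bound 1 ?_
  filter_upwards [eventually_ge_atTop 0] with s hs
  rw [one_mul, Real.norm_of_nonneg (Real.exp_pos _).le, Real.norm_of_nonneg (Real.exp_pos _).le]
  exact Real.exp_le_exp.2 (by nlinarith)

lemma ExpDecay.zero {F : Type*} [NormedAddCommGroup F] : ExpDecay fun _ : ℝ => (0 : F) :=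
  ⟨1, one_pos, isBigO_zero _ _⟩

lemma ExpDecay.add {F : Type*} [NormedAddCommGroup F] {u v : ℝ → F} (hu : ExpDecay u)
    (hv : ExpDecay v) : ExpDecay fun s => u s + v s := by
  obtain ⟨b, hb, hu⟩ := hu
  obtain ⟨c, hc, hv⟩ := hv
  exact ⟨min b c, lt_min hb hc, (hu.trans (isBigO_exp_neg_mul (min_le_left _ _))).add
    (hv.trans (isBigO_exp_neg_mul (min_le_right _ _)))⟩

lemma ExpDecay.sum {F ι : Type*} [NormedAddCommGroup F] (t : Finset ι) {u : ι → ℝ → F}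
    (hu : ∀ i ∈ t, ExpDecay (u i)) : ExpDecay fun s => ∑ i ∈ t, u i s := by
  classical
  induction t using Finset.induction_on with
  | empty => simpa using ExpDecay.zero
  | insert a t ha ih =>
    simp only [Finset.sum_insert ha]
    exact (hu a (by simp)).add (ih fun i hi => hu i (by simp [hi]))

lemma ExpDecay.mul {u v : ℝ → ℝ} (hu : ExpDecay u) (hv : ExpDecay v) :
    ExpDecay fun s => u s * v s := by
  obtain ⟨b, hb, hu⟩ := hu
  obtain ⟨c, hc, hv⟩ := hv
  refine ⟨b + c, add_pos hb hc, (hu.mul hv).congr_right fun s => ?_⟩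
  rw [← Real.exp_add]
  ring_nf

lemma ExpDecay.mul_const {u : ℝ → ℝ} (hu : ExpDecay u) (a : ℝ) :
    ExpDecay fun s => u s * a := by
  obtain ⟨b, hb, hu⟩ := hu
  refine ⟨b, hb, ?_⟩
  simpa using hu.mul (isBigO_refl (fun _ : ℝ => a) atTop) |>.trans
    (isBigO_of_le' (c := ‖a‖) _ fun s => by simp [mul_comm])

lemma ExpDecay.tendsto {F : Type*} [NormedAddCommGroup F] {u : ℝ → F} (hu : ExpDecay u) :
    Tendsto u atTop (nhds 0) := by
  obtain ⟨c, hc, hu⟩ := hu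
  refine hu.trans_tendsto (Real.tendsto_exp_atBot.comp ?_)
  exact tendsto_id.const_mul_atTop_of_neg (by linarith)

lemma ExpDecay.integrableOn {u : ℝ → ℝ} (hu : ExpDecay u) (hc : Continuous u) (a : ℝ) :
    IntegrableOn u (Set.Ioi a) := by
  obtain ⟨c, hc', hu⟩ := hu
  exact integrable_of_isBigO_exp_neg hc' hc.continuousOn hu

/-- On the kernel of `(A - μ)^n` the exponential of `s A` is `e^{s μ}` times a polynomial in `s`. -/
lemma exp_smul_mulVec_of_pow_mulVec_eq_zero {d : ℕ} (A : Matrix (Fin d) (Fin d) ℂ) (μ : ℂ) (n : ℕ)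
    (v : Fin d → ℂ) (hv : (A - μ • (1 : Matrix (Fin d) (Fin d) ℂ)) ^ n *ᵥ v = 0) (s : ℝ) :
    NormedSpace.exp ((s : ℂ) • A) *ᵥ v = ∑ k ∈ Finset.range n, (Complex.exp (s * μ) *
      ((k.factorial : ℂ)⁻¹ * (s : ℂ) ^ k)) •
        ((A - μ • (1 : Matrix (Fin d) (Fin d) ℂ)) ^ k *ᵥ v) := by
  open scoped Matrix.Norms.Operator in
  set N := A - μ • (1 : Matrix (Fin d) (Fin d) ℂ) with hN
  have hsplit : (s : ℂ) • A = (s * μ) • (1 : Matrix (Fin d) (Fin d) ℂ) + (s : ℂ) • N := by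
    rw [hN, smul_sub, smul_smul]; abel
  have h1 : NormedSpace.exp ((s * μ) • (1 : Matrix (Fin d) (Fin d) ℂ)) =
      Complex.exp (s * μ) • 1 := by
    rw [← Algebra.algebraMap_eq_smul_one, ← Algebra.algebraMap_eq_smul_one,
      Complex.exp_eq_exp_ℂ]
    exact (NormedSpace.algebraMap_exp_comm _).symm
  have h2 : NormedSpace.exp ((s : ℂ) • N) *ᵥ v =
      ∑ k ∈ Finset.range n, ((k.factorial : ℂ)⁻¹ * (s : ℂ) ^ k) • (N ^ k *ᵥ v) := by
    have hs := NormedSpace.exp_series_hasSum_exp' (𝕂 := ℂ) ((s : ℂ) • N)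
    let L : Matrix (Fin d) (Fin d) ℂ →ₗ[ℂ] (Fin d → ℂ) := (Matrix.mulVecBilin ℂ ℂ).flip v
    have hs' := hs.mapL L.toContinuousLinearMap
    refine hs'.unique ?_
    have hterm : ∀ k : ℕ, L.toContinuousLinearMap ((k.factorial : ℂ)⁻¹ • ((s : ℂ) • N) ^ k) =
        ((k.factorial : ℂ)⁻¹ * (s : ℂ) ^ k) • (N ^ k *ᵥ v) := by
      intro k
      simp only [LinearMap.coe_toContinuousLinearMap', map_smul, smul_pow, L, smul_smul]
      rfl
    simp only [hterm]
    refine hasSum_sum_of_ne_finset_zero fun k hk => ?_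
    have hk : n ≤ k := by simpa using hk
    obtain ⟨m, rfl⟩ := Nat.exists_eq_add_of_le' hk
    rw [pow_add N, ← Matrix.mulVec_mulVec, hv, Matrix.mulVec_zero, smul_zero]
  rw [hsplit, Matrix.exp_add_of_commute _ _ ((Commute.one_left _).smul_left _), h1,
    smul_mul_assoc, one_mul, Matrix.smul_mulVec, h2, Finset.smul_sum]
  simp only [smul_smul]

/-- If the spectrum of `A` lies in the open left half plane, then `e^{sA} v` decays exponentially: it
suffices to look at generalized eigenvectors `v`, which span the space. -/
lemma expDecay_exp_smul_mulVec {d : ℕ} (A : Matrix (Fin d) (Fin d) ℂ)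
    (hA : ∀ μ ∈ spectrum ℂ A, μ.re < 0) (v : Fin d → ℂ) :
    ExpDecay fun s : ℝ => NormedSpace.exp ((s : ℂ) • A) *ᵥ v := by
  have htop := Module.End.iSup_maxGenEigenspace_eq_top (Matrix.toLin' A)
  have hv : v ∈ ⨆ μ, Module.End.maxGenEigenspace (Matrix.toLin' A) μ := by rw [htop]; trivial
  induction hv using Submodule.iSup_induction' with
  | zero => simpa using ExpDecay.zero
  | add x y _ _ hx hy =>
    simp only [Matrix.mulVec_add]
    exact hx.add hy
  | mem μ x hx =>
    by_cases hx0 : x = 0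
    · subst hx0; simpa using ExpDecay.zero
    have hμ : μ.re < 0 := by
      refine hA μ ?_
      rw [← Matrix.spectrum_toLin', ← Module.End.hasEigenvalue_iff_mem_spectrum]
      have h : Module.End.HasUnifEigenvalue (Matrix.toLin' A) μ ⊤ :=
        (Submodule.ne_bot_iff _).2 ⟨x, hx, hx0⟩
      exact h.lt one_pos
    obtain ⟨n, hn⟩ := (Module.End.mem_maxGenEigenspace _ _ _).1 hx
    have hpow : (A - μ • (1 : Matrix (Fin d) (Fin d) ℂ)) ^ n *ᵥ x = 0 := by
      rw [← hn, ← Matrix.toLin'_apply, Matrix.toLin'_pow, map_sub, map_smul,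
        Matrix.toLin'_one]
      rfl
    simp only [exp_smul_mulVec_of_pow_mulVec_eq_zero A μ n x hpow]
    -- Half of the rate of `e^{s μ}` is given up to absorb the polynomial factor `s ^ k`.
    refine ExpDecay.sum _ fun k _ => ⟨-μ.re / 2, by linarith, ?_⟩
    have h1 : (fun s : ℝ => (Complex.exp (s * μ) * ((k.factorial : ℂ)⁻¹ * (s : ℂ) ^ k)) •
        ((A - μ • (1 : Matrix (Fin d) (Fin d) ℂ)) ^ k *ᵥ x)) =O[atTop]
        fun s : ℝ => Real.exp (s * μ.re) * s ^ k := by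
      refine isBigO_of_le' (c := ‖(k.factorial : ℂ)⁻¹‖ *
        ‖(A - μ • (1 : Matrix (Fin d) (Fin d) ℂ)) ^ k *ᵥ x‖) _ fun s => le_of_eq ?_
      simp only [norm_smul, norm_mul, norm_pow, Complex.norm_exp, Complex.norm_real,
        Real.norm_of_nonneg (Real.exp_pos _).le, Complex.re_ofReal_mul]
      ring
    refine h1.trans ?_
    have h2 := (isLittleO_pow_exp_pos_mul_atTop k (b := -μ.re / 2) (by linarith)).isBigO
    refine ((isBigO_refl (fun s : ℝ => Real.exp (s * μ.re)) atTop).mul h2).congr_right fun s => ?_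
    rw [← Real.exp_add]
    ring_nf

lemma expDecay_expMat {d : ℕ} (B : Matrix (Fin d) (Fin d) ℝ)
    (hB : ∀ μ ∈ spectrum ℂ (B.map (algebraMap ℝ ℂ)), μ.re < 0) (i j : Fin d) :
    ExpDecay fun s => expMat B s i j := by
  obtain ⟨c, hc, h⟩ := expDecay_exp_smul_mulVec _ hB (Pi.single j 1)
  refine ⟨c, hc, IsBigO.trans (isBigO_of_le _ fun s => ?_) h⟩
  have hmap : NormedSpace.exp ((s : ℂ) • B.map (algebraMap ℝ ℂ)) =
      (expMat B s).map (algebraMap ℝ ℂ) := by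
    open scoped Matrix.Norms.Operator in
    have h := NormedSpace.map_exp ((algebraMap ℝ ℂ).mapMatrix (m := Fin d))
      (Continuous.matrix_map continuous_id (by fun_prop)) (s • B)
    refine Eq.trans (congrArg NormedSpace.exp ?_) h.symm
    ext i j
    simp
  rw [hmap]
  refine le_trans (le_of_eq ?_) (norm_le_pi_norm _ i)
  simp


/-! ### The covariance matrices -/

lemma expMat_add {d : ℕ} (B : Matrix (Fin d) (Fin d) ℝ) (s t : ℝ) :
    expMat B (s + t) = expMat B s * expMat B t := by
  rw [expMat, add_smul]
  exact Matrix.exp_add_of_commute _ _ (((Commute.refl B).smul_left s).smul_right t)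

lemma expMat_zero {d : ℕ} (B : Matrix (Fin d) (Fin d) ℝ) : expMat B 0 = 1 := by
  simp [expMat]

lemma expMat_transpose {d : ℕ} (B : Matrix (Fin d) (Fin d) ℝ) (s : ℝ) :
    expMat Bᵀ s = (expMat B s)ᵀ := by
  rw [expMat, expMat, ← Matrix.exp_transpose, Matrix.transpose_smul]

lemma hasDerivAt_expMat_apply {d : ℕ} (B : Matrix (Fin d) (Fin d) ℝ) (s : ℝ) (i j : Fin d) :
    HasDerivAt (fun s => expMat B s i j) ((B * expMat B s) i j) s := by
  open scoped Matrix.Norms.Operator in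
  have h : HasDerivAt (fun s : ℝ => NormedSpace.exp (s • B)) (B * NormedSpace.exp (s • B)) s :=
    hasDerivAt_exp_smul_const' B s
  exact (Matrix.entryLinearMap ℝ ℝ i j).toContinuousLinearMap.hasFDerivAt.comp_hasDerivAt s h

lemma continuous_expMat {d : ℕ} (B : Matrix (Fin d) (Fin d) ℝ) : Continuous (expMat B) :=
  continuous_matrix fun i j => continuous_iff_continuousAt.2 fun s =>
    (hasDerivAt_expMat_apply B s i j).continuousAt

/-- The integrand `e^{sB} Q e^{sB*}` of the covariance matrices. -/
noncomputable def covKernel {d : ℕ} (Q B : Matrix (Fin d) (Fin d) ℝ) (s : ℝ) :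
    Matrix (Fin d) (Fin d) ℝ :=
  expMat B s * Q * expMat Bᵀ s

section Covariance

variable {d : ℕ} (Q B : Matrix (Fin d) (Fin d) ℝ)

lemma continuous_covKernel : Continuous (covKernel Q B) :=
  ((continuous_expMat B).mul continuous_const).mul (continuous_expMat Bᵀ)

lemma covKernel_add (s t : ℝ) :
    covKernel Q B (s + t) = expMat B t * covKernel Q B s * (expMat B t)ᵀ := by
  simp only [covKernel, expMat_transpose]
  rw [add_comm, expMat_add, Matrix.transpose_mul]
  simp only [mul_assoc]

lemma hasDerivAt_covKernel_apply (s : ℝ) (i j : Fin d) :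
    HasDerivAt (fun s => covKernel Q B s i j)
      ((B * covKernel Q B s * (1 : Matrix (Fin d) (Fin d) ℝ)) i j +
        ((1 : Matrix (Fin d) (Fin d) ℝ) * covKernel Q B s * Bᵀ) i j) s := by
  have h : HasDerivAt (fun s => ∑ l, (∑ k, expMat B s i k * Q k l) * expMat B s j l)
      (∑ l, ((∑ k, (B * expMat B s) i k * Q k l) * expMat B s j l +
        (∑ k, expMat B s i k * Q k l) * (B * expMat B s) j l)) s :=
    HasDerivAt.fun_sum fun l _ => HasDerivAt.mul
      (HasDerivAt.fun_sum fun k _ => (hasDerivAt_expMat_apply B s i k).mul_const _)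
      (hasDerivAt_expMat_apply B s j l)
  convert h using 1
  · ext s
    simp only [covKernel, expMat_transpose, Matrix.mul_apply, Matrix.transpose_apply]
  · have h1 : B * covKernel Q B s * 1 = (B * expMat B s) * Q * (expMat B s)ᵀ := by
      simp only [covKernel, expMat_transpose, mul_assoc, mul_one]
    have h2 : 1 * covKernel Q B s * Bᵀ = expMat B s * Q * (B * expMat B s)ᵀ := by
      simp only [covKernel, expMat_transpose, Matrix.transpose_mul, mul_assoc, one_mul]
    rw [h1, h2, Matrix.mul_apply, Matrix.mul_apply, Finset.sum_add_distrib]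
    simp only [Matrix.mul_apply (M := _ * expMat B s) (N := Q),
      Matrix.mul_apply (M := expMat B s) (N := Q), Matrix.transpose_apply]

variable {B} in
lemma expDecay_covKernel (hB : ∀ μ ∈ spectrum ℂ (B.map (algebraMap ℝ ℂ)), μ.re < 0)
    (i j : Fin d) : ExpDecay fun s => covKernel Q B s i j := by
  have h : ∀ s, covKernel Q B s i j = ∑ l, (∑ k, expMat B s i k * Q k l) * expMat B s j l :=
    fun s => by
      simp only [covKernel, expMat_transpose, Matrix.mul_apply, Matrix.transpose_apply]
  simp only [h]
  exact ExpDecay.sum _ fun l _ => ExpDecay.mul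
    (ExpDecay.sum _ fun k _ => (expDecay_expMat B hB i k).mul_const _) (expDecay_expMat B hB j l)

variable {B} in
lemma integrableOn_covKernel (hB : ∀ μ ∈ spectrum ℂ (B.map (algebraMap ℝ ℂ)), μ.re < 0)
    (i j : Fin d) (a : ℝ) : IntegrableOn (fun s => covKernel Q B s i j) (Set.Ioi a) :=
  (expDecay_covKernel Q hB i j).integrableOn ((continuous_covKernel Q B).matrix_elem i j) a

lemma integrable_mul_covKernel_mul (S : Set ℝ)
    (h : ∀ i j, IntegrableOn (fun s => covKernel Q B s i j) S) (A C : Matrix (Fin d) (Fin d) ℝ)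
    (i j : Fin d) : IntegrableOn (fun s => (A * covKernel Q B s * C) i j) S := by
  simp only [Matrix.mul_apply]
  exact integrable_finsetSum _ fun l _ => Integrable.mul_const
    (integrable_finsetSum _ fun k _ => (h k l).const_mul _) _

lemma mul_covOver_mul_apply (S : Set ℝ)
    (h : ∀ i j, IntegrableOn (fun s => covKernel Q B s i j) S) (A C : Matrix (Fin d) (Fin d) ℝ)
    (i j : Fin d) :
    (A * covOver Q B S * C) i j = ∫ s in S, (A * covKernel Q B s * C) i j := by
  simp only [Matrix.mul_apply]
  rw [integral_finsetSum _ fun l _ => Integrable.mul_const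
    (integrable_finsetSum _ fun k _ => (h k l).const_mul _) _]
  refine Finset.sum_congr rfl fun l _ => ?_
  rw [integral_mul_const, integral_finsetSum _ fun k _ => (h k l).const_mul _]
  simp only [integral_const_mul]
  rfl

variable {B} in
/-- Splitting the integral at time `t`: `Q_∞ = Q_t + e^{tB} Q_∞ e^{tB*}`. This is the invariance of
`γ_∞` under the semigroup. -/
lemma covQInf_eq_covQ_add (hB : ∀ μ ∈ spectrum ℂ (B.map (algebraMap ℝ ℂ)), μ.re < 0)
    {t : ℝ} (ht : 0 ≤ t) :
    covQInf Q B = covQ Q B t + expMat B t * covQInf Q B * (expMat B t)ᵀ := by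
  ext i j
  rw [Matrix.add_apply, covQInf, mul_covOver_mul_apply Q B _
    fun i j => integrableOn_covKernel Q hB i j 0]
  simp only [← covKernel_add]
  have hshift : ∫ s in Set.Ioi (0 : ℝ), covKernel Q B (s + t) i j =
      ∫ s in Set.Ioi (0 + t), covKernel Q B s i j := by
    have h := (measurePreserving_add_right volume t).setIntegral_preimage_emb
      (measurableEmbedding_addRight t) (fun s => covKernel Q B s i j) (Set.Ioi (0 + t))
    rwa [Set.preimage_add_const_Ioi, add_sub_cancel_right] at h
  rw [hshift]
  change ∫ s in Set.Ioi 0, covKernel Q B s i j = (∫ s in Set.Ioc 0 t, covKernel Q B s i j) + _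
  rw [← setIntegral_union (by rw [zero_add]; exact Set.Ioc_disjoint_Ioi le_rfl) measurableSet_Ioi
    ((integrableOn_covKernel Q hB i j 0).mono_set Set.Ioc_subset_Ioi_self)
    (integrableOn_covKernel Q hB i j _), zero_add, Set.Ioc_union_Ioi_eq_Ioi ht]

variable {B} in
/-- The Lyapunov equation `B Q_∞ + Q_∞ B* = -Q`. -/
lemma lyapunov (hB : ∀ μ ∈ spectrum ℂ (B.map (algebraMap ℝ ℂ)), μ.re < 0) :
    B * covQInf Q B + covQInf Q B * Bᵀ = -Q := by
  have hint := fun i j => integrableOn_covKernel Q hB i j 0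
  ext i j
  have h1 := mul_covOver_mul_apply Q B _ hint B 1 i j
  have h2 := mul_covOver_mul_apply Q B _ hint 1 Bᵀ i j
  rw [mul_one] at h1
  rw [one_mul] at h2
  -- The integrand of `B Q_∞ + Q_∞ B*` is the derivative of `e^{sB} Q e^{sB*}`, which is `Q` at
  -- `s = 0` and tends to `0` at infinity.
  have h3 := integral_Ioi_of_hasDerivAt_of_tendsto' (a := 0)
    (fun s _ => hasDerivAt_covKernel_apply Q B s i j)
    ((integrable_mul_covKernel_mul Q B _ hint B 1 i j).add
      (integrable_mul_covKernel_mul Q B _ hint 1 Bᵀ i j)) (expDecay_covKernel Q hB i j).tendsto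
  rw [Matrix.add_apply, covQInf, h1, h2, ← integral_add
    (integrable_mul_covKernel_mul Q B _ hint B 1 i j)
    (integrable_mul_covKernel_mul Q B _ hint 1 Bᵀ i j)]
  rw [h3]
  simp [covKernel, expMat_zero]

variable {Q} in
lemma posSemidef_covQ (hQ : Q.PosSemidef) (t : ℝ) : (covQ Q B t).PosSemidef := by
  have hker : ∀ s, (covKernel Q B s).PosSemidef := fun s => by
    have := hQ.mul_mul_conjTranspose_same (expMat B s)
    rwa [Matrix.conjTranspose_eq_transpose_of_trivial, ← expMat_transpose] at this
  have hint : ∀ i j, IntegrableOn (fun s => covKernel Q B s i j) (Set.Ioc 0 t) := fun i j =>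
    (((continuous_covKernel Q B).matrix_elem i j).integrableOn_Icc).mono_set Set.Ioc_subset_Icc_self
  refine Matrix.PosSemidef.of_dotProduct_mulVec_nonneg ?_ fun x => ?_
  · ext i j
    exact integral_congr_ae (ae_of_all _ fun s => congrFun₂ (hker s).isHermitian i j)
  · have h : star x ⬝ᵥ (covQ Q B t *ᵥ x) =
        ∫ s in Set.Ioc 0 t, star x ⬝ᵥ (covKernel Q B s *ᵥ x) := by
      simp only [dotProduct, Matrix.mulVec]
      rw [integral_finsetSum _ fun l _ => Integrable.const_mul
        (integrable_finsetSum _ fun k _ => (hint l k).mul_const _) _]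
      refine Finset.sum_congr rfl fun l _ => ?_
      rw [integral_const_mul, integral_finsetSum _ fun k _ => (hint l k).mul_const _]
      simp only [integral_mul_const]
      rfl
    rw [h]
    exact integral_nonneg fun s => (hker s).dotProduct_mulVec_nonneg x

end Covariance

/-! ### Matrix identities for the two parts of the drift -/

lemma expMat_conj {d : ℕ} {S : Matrix (Fin d) (Fin d) ℝ} (hS : IsUnit S)
    (B : Matrix (Fin d) (Fin d) ℝ) (t : ℝ) : expMat (S⁻¹ * B * S) t = S⁻¹ * expMat B t * S := by
  rw [expMat, expMat, ← Matrix.exp_conj' _ _ hS]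
  simp

/-- Two matrices commute if and only if the semigroups they generate do. For the forward direction,
`X` and `Y` are the limits of the commuting difference quotients `(e^{tX} - 1) / t` and
`(e^{tY} - 1) / t`. -/
lemma forall_commute_expMat_iff {d : ℕ} (X Y : Matrix (Fin d) (Fin d) ℝ) :
    (∀ t : ℝ, 0 ≤ t → Commute (expMat X t) (expMat Y t)) ↔ Commute X Y := by
  constructor
  · intro h
    have hlim : ∀ Z : Matrix (Fin d) (Fin d) ℝ, Tendsto (fun t : ℝ => t⁻¹ • (expMat Z t - 1))
        (nhdsWithin 0 (Set.Ioi 0)) (nhds Z) := by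
      intro Z
      refine tendsto_pi_nhds.2 fun i => tendsto_pi_nhds.2 fun j => ?_
      have := (hasDerivAt_expMat_apply Z 0 i j).tendsto_slope_zero_right
      simpa [expMat_zero] using this
    refine tendsto_nhds_unique ((hlim X).mul (hlim Y)) (((hlim Y).mul (hlim X)).congr' ?_)
    filter_upwards [self_mem_nhdsWithin] with t ht
    have hc : Commute (expMat X t - 1) (expMat Y t - 1) :=
      ((h t (le_of_lt ht)).sub_right (Commute.one_right _)).sub_left (Commute.one_left _)
    exact ((hc.smul_left t⁻¹).smul_right t⁻¹).symm
  · intro h t _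
    open scoped Matrix.Norms.Operator in
    exact ((h.smul_left t).smul_right t).exp

section Splitting

variable {d : ℕ} {Q B M R P : Matrix (Fin d) (Fin d) ℝ} {lam : Fin d → ℝ}

lemma diagonal_mul_diagonal_one_div (hlam : ∀ i, 0 < lam i) :
    Matrix.diagonal lam * (Matrix.diagonal fun i => 1 / lam i) = 1 := by
  rw [Matrix.diagonal_mul_diagonal, ← Matrix.diagonal_one]
  congr 1
  ext i
  exact mul_one_div_cancel (hlam i).ne'

/-- The Lyapunov equation in the diagonalizing coordinates: `R D_λ + D_λ R* = 0`. -/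
lemma mul_diagonal_add_diagonal_mul_transpose (hlam : ∀ i, 0 < lam i) (hM : M * Q * Mᵀ = 1)
    (hP : B * P + P * Bᵀ = -Q) (hD : M * P * Mᵀ = Matrix.diagonal lam)
    (hR : M * B * M⁻¹ = -((1 / 2 : ℝ) • Matrix.diagonal fun i => 1 / lam i) + R) :
    R * Matrix.diagonal lam + Matrix.diagonal lam * Rᵀ = 0 := by
  have hu : M⁻¹ * M = 1 := Matrix.nonsing_inv_mul _
    (Matrix.isUnit_det_of_right_inverse (B := Q * Mᵀ) (by rw [← mul_assoc, hM]))
  have hDE := diagonal_mul_diagonal_one_div hlam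
  have hED := mul_eq_one_comm.1 hDE
  have hDt : (Matrix.diagonal lam)ᵀ = Matrix.diagonal lam := Matrix.diagonal_transpose _
  have hEt : (Matrix.diagonal fun i => 1 / lam i)ᵀ = Matrix.diagonal fun i => 1 / lam i :=
    Matrix.diagonal_transpose _
  have hPt : M * Pᵀ * Mᵀ = Matrix.diagonal lam := by
    rw [← hDt, ← hD]; simp [Matrix.transpose_mul, mul_assoc]
  generalize Matrix.diagonal lam = D at *
  generalize (Matrix.diagonal fun i => 1 / lam i) = E at *
  have h1 : M * (B * P) * Mᵀ = (M * B * M⁻¹) * D := by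
    rw [← hD, ← mul_assoc M B P]
    simp only [← mul_assoc]
    rw [mul_assoc (M * B) M⁻¹ M, hu, mul_one]
  have h2 : M * (P * Bᵀ) * Mᵀ = D * (M * B * M⁻¹)ᵀ := by
    have hu' : Mᵀ * (M⁻¹)ᵀ = 1 := by rw [← Matrix.transpose_mul, hu, Matrix.transpose_one]
    rw [← hD, Matrix.transpose_mul, Matrix.transpose_mul]
    simp only [← mul_assoc]
    rw [mul_assoc (M * P) Mᵀ, hu', mul_one]
  have h3 : M * (B * P) * Mᵀ + M * (P * Bᵀ) * Mᵀ = -1 := by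
    rw [← add_mul, ← mul_add, hP, mul_neg, neg_mul, hM]
  rw [h1, h2, hR] at h3
  simp only [Matrix.transpose_add, Matrix.transpose_neg, Matrix.transpose_smul, hEt, add_mul,
    mul_add, neg_mul, mul_neg, smul_mul_assoc, mul_smul_comm, hDE, hED] at h3
  have h4 : -((1 / 2 : ℝ) • (1 : Matrix (Fin d) (Fin d) ℝ)) + R * D +
      (-((1 / 2 : ℝ) • (1 : Matrix (Fin d) (Fin d) ℝ)) + D * Rᵀ) = (R * D + D * Rᵀ) + -1 := by
    module
  rw [h4] at h3
  simpa using h3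

lemma add_transpose_eq_zero_iff_commute (hlam : ∀ i, 0 < lam i)
    (hRD : R * Matrix.diagonal lam + Matrix.diagonal lam * Rᵀ = 0) :
    R + Rᵀ = 0 ↔ Commute (Matrix.diagonal lam) R := by
  have hED := mul_eq_one_comm.1 (diagonal_mul_diagonal_one_div hlam)
  constructor
  · intro h
    rw [eq_neg_of_add_eq_zero_right h, mul_neg, add_neg_eq_zero] at hRD
    exact hRD.symm
  · intro h
    rw [← h.eq, ← mul_add] at hRD
    rw [← one_mul (R + Rᵀ), ← hED, mul_assoc, hRD, mul_zero]

/-- `B*` commutes with `P⁻¹ B P` (where `P = Q_∞`) if and only if `R` commutes with `D_λ`: in the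
diagonalizing coordinates these two matrices are `-½ D_{1/λ} + R*` and `-½ D_{1/λ} - R*`. -/
lemma commute_transpose_conj_iff (hlam : ∀ i, 0 < lam i) (hM : IsUnit M)
    (hD : M * P * Mᵀ = Matrix.diagonal lam)
    (hR : M * B * M⁻¹ = -((1 / 2 : ℝ) • Matrix.diagonal fun i => 1 / lam i) + R)
    (hRD : R * Matrix.diagonal lam + Matrix.diagonal lam * Rᵀ = 0) :
    Commute Bᵀ (P⁻¹ * B * P) ↔ Commute (Matrix.diagonal lam) R := by
  obtain ⟨U, rfl⟩ := hM
  have hDE := diagonal_mul_diagonal_one_div hlam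
  have hED := mul_eq_one_comm.1 hDE
  have hDt : (Matrix.diagonal lam)ᵀ = Matrix.diagonal lam := Matrix.diagonal_transpose _
  have hEt : (Matrix.diagonal fun i => 1 / lam i)ᵀ = Matrix.diagonal fun i => 1 / lam i :=
    Matrix.diagonal_transpose _
  generalize Matrix.diagonal lam = D at *
  generalize (Matrix.diagonal fun i => 1 / lam i) = E at *
  set M : Matrix (Fin d) (Fin d) ℝ := ↑U with hMdef
  have hdet : IsUnit M.det := (Matrix.isUnit_iff_isUnit_det _).1 U.isUnit
  set N := M⁻¹
  have hNM : N * M = 1 := Matrix.nonsing_inv_mul _ hdet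
  have hMN : M * N = 1 := Matrix.mul_nonsing_inv _ hdet
  have hMN' : Mᵀ * Nᵀ = 1 := by rw [← Matrix.transpose_mul, hNM, Matrix.transpose_one]
  have hNM' : Nᵀ * Mᵀ = 1 := by rw [← Matrix.transpose_mul, hMN, Matrix.transpose_one]
  have hP : P = N * D * Nᵀ := by
    rw [← hD]
    simp only [mul_assoc, hMN', mul_one]
    rw [← mul_assoc, hNM, one_mul]
  have hPinv : P⁻¹ = Mᵀ * E * M := by
    refine Matrix.inv_eq_left_inv ?_
    rw [hP]
    calc Mᵀ * E * M * (N * D * Nᵀ) = Mᵀ * E * (M * N) * D * Nᵀ := by simp only [mul_assoc]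
      _ = Mᵀ * (E * D) * Nᵀ := by rw [hMN]; simp only [mul_assoc, one_mul]
      _ = 1 := by rw [hED, mul_one, hMN']
  set Bt := M * B * N with hBt
  have hB : B = N * Bt * M := by
    rw [hBt]
    simp only [← mul_assoc, hNM, one_mul]
    rw [mul_assoc, hNM, mul_one]
  have h1 : Bᵀ = Mᵀ * Btᵀ * Nᵀ := by
    rw [hB, Matrix.transpose_mul, Matrix.transpose_mul, mul_assoc]
  have h2 : P⁻¹ * B * P = Mᵀ * (E * Bt * D) * Nᵀ := by
    rw [hPinv, hB, hP]
    calc Mᵀ * E * M * (N * Bt * M) * (N * D * Nᵀ)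
        = Mᵀ * E * (M * N) * Bt * (M * N) * D * Nᵀ := by simp only [mul_assoc]
      _ = Mᵀ * (E * Bt * D) * Nᵀ := by rw [hMN]; simp only [mul_assoc, one_mul]
  have hconj : ∀ X Y : Matrix (Fin d) (Fin d) ℝ,
      Commute (Mᵀ * X * Nᵀ) (Mᵀ * Y * Nᵀ) ↔ Commute X Y := by
    intro X Y
    have hprod : ∀ X Y : Matrix (Fin d) (Fin d) ℝ,
        Mᵀ * X * Nᵀ * (Mᵀ * Y * Nᵀ) = Mᵀ * (X * Y) * Nᵀ := fun X Y => by
      calc Mᵀ * X * Nᵀ * (Mᵀ * Y * Nᵀ) = Mᵀ * X * (Nᵀ * Mᵀ) * Y * Nᵀ := by simp only [mul_assoc]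
        _ = _ := by rw [hNM']; simp only [mul_assoc, one_mul]
    have hcancel : ∀ X : Matrix (Fin d) (Fin d) ℝ, Nᵀ * (Mᵀ * X * Nᵀ) * Mᵀ = X := fun X => by
      calc Nᵀ * (Mᵀ * X * Nᵀ) * Mᵀ = (Nᵀ * Mᵀ) * X * (Nᵀ * Mᵀ) := by simp only [mul_assoc]
        _ = X := by rw [hNM', one_mul, mul_one]
    rw [commute_iff_eq, commute_iff_eq, hprod, hprod]
    refine ⟨fun h => ?_, fun h => by rw [h]⟩
    rw [← hcancel (X * Y), h, hcancel]
  have h3 : Btᵀ = -((1 / 2 : ℝ) • E) + Rᵀ := by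
    rw [hR, Matrix.transpose_add, Matrix.transpose_neg, Matrix.transpose_smul, hEt]
  have h4 : E * Bt * D = -((1 / 2 : ℝ) • E) - Rᵀ := by
    have : E * R * D = -Rᵀ := by
      rw [mul_assoc, eq_neg_of_add_eq_zero_left hRD, mul_neg, ← mul_assoc, hED, one_mul]
    rw [hR, mul_add, add_mul, this]
    simp only [mul_neg, neg_mul, mul_smul_comm, smul_mul_assoc]
    rw [mul_assoc, hED, mul_one, sub_eq_add_neg]
  have h5 : Commute E Rᵀ ↔ Commute D Rᵀ := by
    rw [commute_iff_eq, commute_iff_eq]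
    constructor <;> intro h
    · calc D * Rᵀ = D * (Rᵀ * E) * D := by simp only [mul_assoc, hED, mul_one]
        _ = (D * E) * Rᵀ * D := by rw [← h]; simp only [mul_assoc]
        _ = Rᵀ * D := by rw [hDE, one_mul]
    · calc E * Rᵀ = E * (Rᵀ * D) * E := by simp only [mul_assoc, hDE, mul_one]
        _ = (E * D) * Rᵀ * E := by rw [← h]; simp only [mul_assoc]
        _ = Rᵀ * E := by rw [hED, one_mul]
  have h6 : Commute D Rᵀ ↔ Commute D R := by
    rw [commute_iff_eq, commute_iff_eq, ← Matrix.transpose_inj]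
    simp only [Matrix.transpose_mul, Matrix.transpose_transpose, hDt]
    exact eq_comm
  rw [h1, h2, hconj, h3, h4, ← h6, ← h5, commute_iff_eq, commute_iff_eq, ← sub_eq_zero,
    ← sub_eq_zero (a := E * Rᵀ)]
  have h7 : (-((1 / 2 : ℝ) • E) + Rᵀ) * (-((1 / 2 : ℝ) • E) - Rᵀ) -
      (-((1 / 2 : ℝ) • E) - Rᵀ) * (-((1 / 2 : ℝ) • E) + Rᵀ) = E * Rᵀ - Rᵀ * E := by
    simp only [add_mul, sub_mul, mul_add, mul_sub, neg_mul, mul_neg, smul_mul_assoc,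
      mul_smul_comm]
    module
  rw [h7]

end Splitting

/-! ### Transition operators on `L²` of an invariant measure -/

section Transition

variable {α β : Type*} [MeasurableSpace α] [MeasurableSpace β] {μ : Measure α} {ν : Measure β}
  [IsProbabilityMeasure ν] {S : α × β → α}

variable (𝕜 : Type*) [RCLike 𝕜]

variable (μ ν) in
/-- The isometric embedding `g ↦ g ∘ fst` of `L²(μ)` into `L²(μ × ν)`. -/
noncomputable def fstEmbedding : Lp 𝕜 2 μ →L[𝕜] Lp 𝕜 2 (μ.prod ν) :=
  (Lp.compMeasurePreservingₗᵢ 𝕜 Prod.fst measurePreserving_fst).toContinuousLinearMap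

/-- If `S` maps `μ × ν` to `μ`, the operator `f ↦ ∫ f (S (·, y)) dν(y)` on `L²(μ)`, written as the
isometry `f ↦ f ∘ S` into `L²(μ × ν)` followed by the adjoint of `g ↦ g ∘ fst`, which integrates
out the second variable. -/
noncomputable def transitionOp (hS : MeasurePreserving S (μ.prod ν) μ) :
    Lp 𝕜 2 μ →L[𝕜] Lp 𝕜 2 μ :=
  ContinuousLinearMap.adjoint (fstEmbedding μ ν 𝕜) ∘L
    (Lp.compMeasurePreservingₗᵢ 𝕜 S hS).toContinuousLinearMap

variable {𝕜}

/-- The adjoint of `g ↦ g ∘ fst` integrates out the second variable; this is checked by pairing with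
indicator functions. -/
lemma adjoint_fstEmbedding_ae_eq [IsProbabilityMeasure μ] (h : Lp 𝕜 2 (μ.prod ν)) :
    ⇑(ContinuousLinearMap.adjoint (fstEmbedding μ ν 𝕜) h) =ᵐ[μ] fun x => ∫ y, h (x, y) ∂ν := by
  have hint : Integrable h (μ.prod ν) := (Lp.memLp h).integrable one_le_two
  refine Integrable.ae_eq_of_forall_setIntegral_eq _ _
    ((Lp.memLp _).integrable one_le_two) hint.integral_prod_left fun s hs hμs => ?_
  rw [← L2.inner_indicatorConstLp_one (𝕜 := 𝕜) hs hμs.ne,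
    ContinuousLinearMap.adjoint_inner_right]
  have h1 : fstEmbedding μ ν 𝕜 (indicatorConstLp 2 hs hμs.ne (1 : 𝕜)) =
      indicatorConstLp 2 (measurable_fst hs) (measure_ne_top _ _) (1 : 𝕜) :=
    (Lp.indicatorConstLp_compMeasurePreserving hs hμs.ne (1 : 𝕜) measurePreserving_fst).symm
  rw [h1, L2.inner_indicatorConstLp_one, ← Set.prod_univ, setIntegral_prod _ hint.integrableOn]
  simp

lemma transitionOp_ae_eq [IsProbabilityMeasure μ] (hS : MeasurePreserving S (μ.prod ν) μ)
    (f : Lp 𝕜 2 μ) :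
    ⇑(transitionOp 𝕜 hS f) =ᵐ[μ] fun x => ∫ y, f (S (x, y)) ∂ν := by
  refine (adjoint_fstEmbedding_ae_eq _).trans ?_
  filter_upwards [Measure.ae_ae_of_ae_prod (Lp.coeFn_compMeasurePreserving f hS)] with x hx
  exact integral_congr_ae hx

lemma inner_transitionOp (hS : MeasurePreserving S (μ.prod ν) μ) {f g : α → 𝕜}
    (hf : MemLp f 2 μ) (hg : MemLp g 2 μ) :
    ⟪hg.toLp g, transitionOp 𝕜 hS (hf.toLp f)⟫_𝕜 =
      ∫ z, f (S z) * starRingEnd 𝕜 (g z.1) ∂(μ.prod ν) := by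
  rw [transitionOp, ContinuousLinearMap.comp_apply, ContinuousLinearMap.adjoint_inner_right]
  have h1 : fstEmbedding μ ν 𝕜 (hg.toLp g) =
    (hg.comp_measurePreserving measurePreserving_fst).toLp (g ∘ Prod.fst) := rfl
  have h2 : (Lp.compMeasurePreservingₗᵢ 𝕜 S hS).toContinuousLinearMap (hf.toLp f) =
    (hf.comp_measurePreserving hS).toLp (f ∘ S) := rfl
  rw [h1, h2, L2.inner_def]
  refine integral_congr_ae ?_
  filter_upwards [(hg.comp_measurePreserving (measurePreserving_fst (ν := ν))).coeFn_toLp,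
    (hf.comp_measurePreserving hS).coeFn_toLp] with z hz1 hz2
  rw [hz1, hz2, RCLike.inner_apply]
  rfl

end Transition

/-! ### Exponential functions are total in `L²` -/

section Exponentials

variable {E : Type*} [NormedAddCommGroup E] [InnerProductSpace ℝ E] [FiniteDimensional ℝ E]
  [MeasurableSpace E] [BorelSpace E] {γ : Measure E}

/-- `γ` has the moment generating function of a centred Gaussian measure with covariance `P`. -/
def HasGaussianMGF (γ : Measure E) (P : E →L[ℝ] E) : Prop :=
  ∀ ξ : E, Integrable (fun x => Real.exp ⟪ξ, x⟫_ℝ) γ ∧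
    ∫ x, Real.exp ⟪ξ, x⟫_ℝ ∂γ = Real.exp (⟪ξ, P ξ⟫_ℝ / 2)

lemma memLp_exp_inner (h : ∀ ξ : E, Integrable (fun x => Real.exp ⟪ξ, x⟫_ℝ) γ) (ξ : E) :
    MemLp (fun x => Real.exp ⟪ξ, x⟫_ℝ) 2 γ := by
  refine (memLp_two_iff_integrable_sq (by fun_prop)).2 ?_
  refine (h ((2 : ℝ) • ξ)).congr (ae_of_all _ fun x => ?_)
  simp only [inner_smul_left, ← Real.exp_nat_mul]
  simp

/-- A real function in `L²(γ)` that is orthogonal to all exponentials vanishes: its positive and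
negative parts are densities of two measures with the same moment generating function in every
direction. -/
lemma ae_eq_zero_of_forall_integral_exp_inner_mul [IsFiniteMeasure γ]
    (h : ∀ ξ : E, Integrable (fun x => Real.exp ⟪ξ, x⟫_ℝ) γ) {f : E → ℝ} (hf : MemLp f 2 γ)
    (h0 : ∀ ξ : E, ∫ x, Real.exp ⟪ξ, x⟫_ℝ * f x ∂γ = 0) : f =ᵐ[γ] 0 := by
  have hint : ∀ {g : E → ℝ}, MemLp g 2 γ → ∀ ξ : E,
      Integrable (fun x => Real.exp ⟪ξ, x⟫_ℝ * g x) γ := fun hg ξ =>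
    (memLp_exp_inner h ξ).integrable_mul hg
  have hp : MemLp (fun x => max (f x) 0) 2 γ := hf.pos_part
  have hn : MemLp (fun x => max (-f x) 0) 2 γ := hf.neg_part
  -- `m f⁺` and `m f⁻` are the finite measures with densities `f⁺` and `f⁻`.
  let m : (E → ℝ) → Measure E := fun g => γ.withDensity fun x => ENNReal.ofReal (g x)
  have hfin : ∀ g : E → ℝ, MemLp g 2 γ → IsFiniteMeasure (m g) := fun g hg =>
    isFiniteMeasure_withDensity_ofReal (hg.integrable one_le_two).2
  have hm : ∀ g : E → ℝ, MemLp g 2 γ → (∀ x, 0 ≤ g x) → ∀ (ξ : E),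
      Integrable (fun x => Real.exp ⟪ξ, x⟫_ℝ) (m g) ∧
      ∫ x, Real.exp ⟪ξ, x⟫_ℝ ∂(m g) = ∫ x, Real.exp ⟪ξ, x⟫_ℝ * g x ∂γ := by
    intro g hg hg0 ξ
    have hgm : AEMeasurable (fun x => ENNReal.ofReal (g x)) γ :=
      hg.aestronglyMeasurable.aemeasurable.ennreal_ofReal
    constructor
    · rw [integrable_withDensity_iff_integrable_smul₀' hgm
        (ae_of_all _ fun _ => ENNReal.ofReal_lt_top)]
      refine (hint hg ξ).congr (ae_of_all _ fun x => ?_)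
      simp [ENNReal.toReal_ofReal (hg0 x), mul_comm]
    · rw [integral_withDensity_eq_integral_toReal_smul₀ hgm
        (ae_of_all _ fun _ => ENNReal.ofReal_lt_top)]
      refine integral_congr_ae (ae_of_all _ fun x => ?_)
      simp [ENNReal.toReal_ofReal (hg0 x), mul_comm]
  have hp' := hm _ hp fun x => le_max_right _ _
  have hn' := hm _ hn fun x => le_max_right _ _
  have := hfin _ hp
  have := hfin _ hn
  have hmgf : ∀ ξ : E, mgf (fun x => ⟪ξ, x⟫_ℝ) (m fun x => max (f x) 0) =
      mgf (fun x => ⟪ξ, x⟫_ℝ) (m fun x => max (-f x) 0) := by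
    intro ξ
    ext t
    have ht : ∀ x, t * ⟪ξ, x⟫_ℝ = ⟪t • ξ, x⟫_ℝ := fun x => by simp [inner_smul_left]
    simp only [mgf, ht]
    rw [(hp' _).2, (hn' _).2, ← sub_eq_zero, ← integral_sub (hint hp _) (hint hn _)]
    refine Eq.trans ?_ (h0 (t • ξ))
    refine integral_congr_ae (ae_of_all _ fun x => ?_)
    simp only [← mul_sub]
    congr 1
    rcases le_total (f x) 0 with hx | hx <;> simp [hx]
  have hmass : (m fun x => max (f x) 0) = 0 ↔ (m fun x => max (-f x) 0) = 0 := by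
    have h1 := congrFun (hmgf 0) 0
    simp only [mgf_zero', measureReal_def] at h1
    rw [← Measure.measure_univ_eq_zero, ← Measure.measure_univ_eq_zero,
      (ENNReal.toReal_eq_toReal_iff' (measure_ne_top _ _) (measure_ne_top _ _)).1 h1]
  have heq : (m fun x => max (f x) 0) = m fun x => max (-f x) 0 := by
    refine Measure.ext_of_charFun (funext fun ξ => ?_)
    -- The characteristic function at `ξ` is the analytic continuation of the moment generating
    -- function in direction `ξ`, taken at the point `i`.
    have h1 := eqOn_complexMGF_of_mgf' (hmgf ξ) hmass (x := Complex.I) (by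
      have : integrableExpSet (fun x => ⟪ξ, x⟫_ℝ) (m fun x => max (f x) 0) = Set.univ := by
        refine Set.eq_univ_of_forall fun t => ?_
        have ht : ∀ x, t * ⟪ξ, x⟫_ℝ = ⟪t • ξ, x⟫_ℝ := fun x => by simp [inner_smul_left]
        simp only [integrableExpSet, Set.mem_ofPred_eq, ht]
        exact (hp' _).1
      simp [this])
    simp only [complexMGF] at h1
    simp only [charFun_apply]
    simpa only [mul_comm Complex.I, real_inner_comm ξ] using h1
  have hae := (withDensity_eq_iff hp.aestronglyMeasurable.aemeasurable.ennreal_ofReal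
    hn.aestronglyMeasurable.aemeasurable.ennreal_ofReal
    (by
      have := measure_ne_top (m fun x => max (f x) 0) Set.univ
      simpa [m] using this)).1 heq
  filter_upwards [hae] with x hx
  rw [ENNReal.ofReal_eq_ofReal_iff (le_max_right _ _) (le_max_right _ _)] at hx
  rcases le_total (f x) 0 with hx' | hx' <;> simp_all

/-- The normalized exponential `exp (⟪ξ, x⟫ - ⟪ξ, P ξ⟫ / 2)`. -/
noncomputable def expFun (𝕜 : Type*) [RCLike 𝕜] (P : E →L[ℝ] E) (ξ x : E) : 𝕜 :=
  ((Real.exp (⟪ξ, x⟫_ℝ - ⟪ξ, P ξ⟫_ℝ / 2) : ℝ) : 𝕜)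

variable {P : E →L[ℝ] E}

lemma HasGaussianMGF.memLp_expFun (𝕜 : Type*) [RCLike 𝕜] (h : HasGaussianMGF γ P) (ξ : E) :
    MemLp (expFun 𝕜 P ξ) 2 γ := by
  refine MemLp.ofReal ?_
  simp only [Real.exp_sub, div_eq_mul_inv]
  exact (memLp_exp_inner (fun ξ => (h ξ).1) ξ).mul_const _

/-- The coherent vector at `ξ`: the class in `L²(γ)` of the normalized exponential. -/
noncomputable def coherent (𝕜 : Type*) [RCLike 𝕜] (h : HasGaussianMGF γ P) (ξ : E) :
    Lp 𝕜 2 γ :=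
  (h.memLp_expFun 𝕜 ξ).toLp _

/-- The coherent vectors span a dense subspace of `L²(γ)`, over the reals as over `ℂ`. -/
lemma coherent_total {𝕜 : Type*} [RCLike 𝕜] [IsFiniteMeasure γ] (h : HasGaussianMGF γ P)
    {f : Lp 𝕜 2 γ} (hf : ∀ ξ, ⟪coherent 𝕜 h ξ, f⟫_𝕜 = 0) : f = 0 := by
  have hexp := fun ξ => (h ξ).1
  have hfm : MemLp f 2 γ := Lp.memLp f
  have hzero : ∀ ξ : E, ∫ x, ((Real.exp ⟪ξ, x⟫_ℝ : ℝ) : 𝕜) * f x ∂γ = 0 := by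
    intro ξ
    have h1 := hf ξ
    rw [L2.inner_def] at h1
    have h2 : ∫ x, ⟪coherent 𝕜 h ξ x, f x⟫_𝕜 ∂γ =
        ((Real.exp (-(⟪ξ, P ξ⟫_ℝ / 2)) : ℝ) : 𝕜) * ∫ x, ((Real.exp ⟪ξ, x⟫_ℝ : ℝ) : 𝕜) * f x ∂γ := by
      rw [← integral_const_mul]
      refine integral_congr_ae ?_
      filter_upwards [(h.memLp_expFun 𝕜 ξ).coeFn_toLp] with x hx
      rw [coherent, hx, RCLike.inner_apply, expFun, RCLike.conj_ofReal, sub_eq_add_neg,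
        Real.exp_add, RCLike.ofReal_mul]
      ring
    rw [h2] at h1
    refine (mul_eq_zero.1 h1).resolve_left ?_
    exact_mod_cast (Real.exp_pos _).ne'
  have hint : ∀ ξ : E, Integrable (fun x => ((Real.exp ⟪ξ, x⟫_ℝ : ℝ) : 𝕜) * f x) γ := fun ξ =>
    (memLp_exp_inner hexp ξ).ofReal.integrable_mul hfm
  have hre := ae_eq_zero_of_forall_integral_exp_inner_mul hexp hfm.re fun ξ => by
    have h1 := integral_re (hint ξ)
    rw [hzero ξ, map_zero] at h1
    simpa using h1
  have him := ae_eq_zero_of_forall_integral_exp_inner_mul hexp hfm.im fun ξ => by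
    have h1 := integral_im (hint ξ)
    rw [hzero ξ, map_zero] at h1
    simpa using h1
  refine (Lp.eq_zero_iff_ae_eq_zero).2 ?_
  filter_upwards [hre, him] with x h1 h2
  exact RCLike.ext (by simpa using h1) (by simpa using h2)

lemma coherent_ext {𝕜 : Type*} [RCLike 𝕜] [IsFiniteMeasure γ] (h : HasGaussianMGF γ P)
    {f g : Lp 𝕜 2 γ} (hf : ∀ ξ, ⟪coherent 𝕜 h ξ, f⟫_𝕜 = ⟪coherent 𝕜 h ξ, g⟫_𝕜) : f = g :=
  sub_eq_zero.1 (coherent_total h fun ξ => by rw [inner_sub_right, hf, sub_self])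

lemma inner_coherent {𝕜 : Type*} [RCLike 𝕜] (h : HasGaussianMGF γ P)
    (hP : ∀ ξ η, ⟪P ξ, η⟫_ℝ = ⟪ξ, P η⟫_ℝ) (ξ η : E) :
    ⟪coherent 𝕜 h ξ, coherent 𝕜 h η⟫_𝕜 = ((Real.exp ⟪ξ, P η⟫_ℝ : ℝ) : 𝕜) := by
  rw [L2.inner_def]
  have h1 : ∫ x, ⟪coherent 𝕜 h ξ x, coherent 𝕜 h η x⟫_𝕜 ∂γ =
      ∫ x, ((Real.exp ⟪ξ + η, x⟫_ℝ *
        Real.exp (-(⟪ξ, P ξ⟫_ℝ / 2) - ⟪η, P η⟫_ℝ / 2) : ℝ) : 𝕜) ∂γ := by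
    refine integral_congr_ae ?_
    filter_upwards [(h.memLp_expFun 𝕜 ξ).coeFn_toLp, (h.memLp_expFun 𝕜 η).coeFn_toLp] with x h1 h2
    rw [coherent, coherent, h1, h2, RCLike.inner_apply, expFun, expFun, RCLike.conj_ofReal,
      ← RCLike.ofReal_mul, ← Real.exp_add, ← Real.exp_add, inner_add_left]
    ring_nf
  have h2 : ⟪η, P ξ⟫_ℝ = ⟪ξ, P η⟫_ℝ := by rw [real_inner_comm, hP]
  rw [h1, integral_ofReal, integral_mul_const, (h _).2, ← Real.exp_add, map_add,
    inner_add_left, inner_add_right, inner_add_right, h2]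
  ring_nf

lemma coherent_injective {𝕜 : Type*} [RCLike 𝕜] (h : HasGaussianMGF γ P)
    (hP : ∀ ξ η, ⟪P ξ, η⟫_ℝ = ⟪ξ, P η⟫_ℝ) (hinj : Function.Injective P) :
    Function.Injective (coherent 𝕜 h) := by
  intro ξ η hξη
  refine hinj (ext_inner_left ℝ fun ζ => ?_)
  have h1 := inner_coherent (𝕜 := 𝕜) h hP ζ ξ
  rw [hξη, inner_coherent h hP, RCLike.ofReal_inj] at h1
  exact (Real.exp_injective h1).symm

/-! ### Normality in terms of coherent vectors -/

section Normality

variable {𝕜 : Type*} [RCLike 𝕜] {ν : Measure E} [IsProbabilityMeasure γ] [IsProbabilityMeasure ν]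
  {C N K : E →L[ℝ] E}

lemma transitionOp_coherent (hγ : HasGaussianMGF γ P) (hν : HasGaussianMGF ν N)
    (hP : ∀ ξ η, ⟪P ξ, η⟫_ℝ = ⟪ξ, P η⟫_ℝ)
    (hPN : ∀ ξ, P ξ = N ξ + C (P (ContinuousLinearMap.adjoint C ξ)))
    (hS : MeasurePreserving (fun z : E × E => C z.1 - z.2) (γ.prod ν) γ) (ξ : E) :
    transitionOp 𝕜 hS (coherent 𝕜 hγ ξ) = coherent 𝕜 hγ (ContinuousLinearMap.adjoint C ξ) := by
  refine coherent_ext hγ fun η => ?_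
  rw [inner_coherent hγ hP, coherent, coherent, inner_transitionOp]
  set ζ := ContinuousLinearMap.adjoint C ξ with hζ
  have h1 : ∀ z : E × E, expFun 𝕜 P ξ (C z.1 - z.2) * starRingEnd 𝕜 (expFun 𝕜 P η z.1) =
      ((Real.exp ⟪η + ζ, z.1⟫_ℝ * (Real.exp ⟪-ξ, z.2⟫_ℝ *
        Real.exp (-(⟪ξ, P ξ⟫_ℝ / 2) - ⟪η, P η⟫_ℝ / 2)) : ℝ) : 𝕜) := by
    intro z
    rw [expFun, expFun, RCLike.conj_ofReal, ← RCLike.ofReal_mul, ← Real.exp_add, ← Real.exp_add,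
      ← Real.exp_add, inner_add_left, inner_sub_right, inner_neg_left, hζ,
      ContinuousLinearMap.adjoint_inner_left]
    ring_nf
  simp only [h1]
  rw [integral_ofReal, integral_prod_mul (fun x => Real.exp ⟪η + ζ, x⟫_ℝ)
    (fun y => Real.exp ⟪-ξ, y⟫_ℝ * Real.exp (-(⟪ξ, P ξ⟫_ℝ / 2) - ⟪η, P η⟫_ℝ / 2)),
    integral_mul_const, (hγ _).2, (hν _).2, ← Real.exp_add, ← Real.exp_add]
  have h2 : ⟪ζ, P η⟫_ℝ = ⟪η, P ζ⟫_ℝ := by rw [← hP, real_inner_comm]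
  have h3 : ⟪ξ, P ξ⟫_ℝ = ⟪ξ, N ξ⟫_ℝ + ⟪ζ, P ζ⟫_ℝ := by
    rw [hPN, inner_add_right, ← ContinuousLinearMap.adjoint_inner_left C]
  rw [map_add, map_neg, inner_neg_neg, inner_add_left, inner_add_right, inner_add_right, h2, h3]
  ring_nf

/-- The hypothesis on `K` says that `K = P⁻¹ C P`. -/
lemma adjoint_transitionOp_coherent (hγ : HasGaussianMGF γ P) (hν : HasGaussianMGF ν N)
    (hP : ∀ ξ η, ⟪P ξ, η⟫_ℝ = ⟪ξ, P η⟫_ℝ)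
    (hPN : ∀ ξ, P ξ = N ξ + C (P (ContinuousLinearMap.adjoint C ξ)))
    (hS : MeasurePreserving (fun z : E × E => C z.1 - z.2) (γ.prod ν) γ)
    (hK : ∀ ξ, P (K ξ) = C (P ξ)) (ξ : E) :
    ContinuousLinearMap.adjoint (transitionOp 𝕜 hS) (coherent 𝕜 hγ ξ) =
      coherent 𝕜 hγ (K ξ) := by
  refine coherent_ext hγ fun η => ?_
  rw [ContinuousLinearMap.adjoint_inner_right, transitionOp_coherent hγ hν hP hPN hS,
    inner_coherent hγ hP, inner_coherent hγ hP, ContinuousLinearMap.adjoint_inner_left, hK]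

/-- A Gaussian transition operator and its adjoint act on coherent vectors through the matrices
`C*` and `K = P⁻¹ C P`, so the operator is normal if and only if these commute. -/
lemma transitionOp_normal_iff (hγ : HasGaussianMGF γ P) (hν : HasGaussianMGF ν N)
    (hP : ∀ ξ η, ⟪P ξ, η⟫_ℝ = ⟪ξ, P η⟫_ℝ) (hinj : Function.Injective P)
    (hPN : ∀ ξ, P ξ = N ξ + C (P (ContinuousLinearMap.adjoint C ξ)))
    (hS : MeasurePreserving (fun z : E × E => C z.1 - z.2) (γ.prod ν) γ)
    (hK : ∀ ξ, P (K ξ) = C (P ξ)) :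
    transitionOp 𝕜 hS * ContinuousLinearMap.adjoint (transitionOp 𝕜 hS) =
      ContinuousLinearMap.adjoint (transitionOp 𝕜 hS) * transitionOp 𝕜 hS ↔
      Commute (ContinuousLinearMap.adjoint C) K := by
  have hT := transitionOp_coherent (𝕜 := 𝕜) hγ hν hP hPN hS
  have hT' := adjoint_transitionOp_coherent (𝕜 := 𝕜) hγ hν hP hPN hS hK
  set T := transitionOp 𝕜 hS
  constructor
  · intro h
    refine ContinuousLinearMap.ext fun ξ => coherent_injective (𝕜 := 𝕜) hγ hP hinj ?_
    have h1 := congrArg (fun A => A (coherent 𝕜 hγ ξ)) h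
    simpa only [mul_apply_eq_comp, hT, hT'] using h1
  · intro h
    refine ContinuousLinearMap.ext fun f => coherent_ext hγ fun ξ => ?_
    have h1 : ContinuousLinearMap.adjoint C (K ξ) = K (ContinuousLinearMap.adjoint C ξ) :=
      congrArg (fun A => A ξ) h.eq
    have e1 : (T * ContinuousLinearMap.adjoint T) f = T (ContinuousLinearMap.adjoint T f) := rfl
    have e2 : (ContinuousLinearMap.adjoint T * T) f = ContinuousLinearMap.adjoint T (T f) := rfl
    rw [e1, e2, ← ContinuousLinearMap.adjoint_inner_left T,
      ContinuousLinearMap.adjoint_inner_right T, ContinuousLinearMap.adjoint_inner_right T,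
      ← ContinuousLinearMap.adjoint_inner_left T, hT', hT, hT, hT', h1]

end Normality

end Exponentials

/-! ### The commutator of the two parts of the generator -/

section Commutator

section Directional

variable {E F : Type*} [NormedAddCommGroup E] [NormedSpace ℝ E] [NormedAddCommGroup F]
  [NormedSpace ℝ F]

/-- The derivative of `f` in the constant direction `v`, as a function. -/
noncomputable def dirDeriv (v : E) (f : E → F) (x : E) : F :=
  fderiv ℝ f x v

/-- The first order operator `⟨Ax, ∇⟩` for a continuous linear map `A`. -/
noncomputable def linDrift (A : E →L[ℝ] E) (f : E → F) (x : E) : F :=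
  fderiv ℝ f x (A x)

variable {f : E → F}

lemma contDiff_dirDeriv (hf : ContDiff ℝ ∞ f) (v : E) : ContDiff ℝ ∞ (dirDeriv v f) :=
  (hf.fderiv_right (m := ∞) (by simp)).clm_apply contDiff_const

lemma contDiff_linDrift (hf : ContDiff ℝ ∞ f) (A : E →L[ℝ] E) : ContDiff ℝ ∞ (linDrift A f) :=
  (hf.fderiv_right (m := ∞) (by simp)).clm_apply A.contDiff

lemma dirDeriv_dirDeriv (hf : ContDiff ℝ ∞ f) (u v x : E) :
    dirDeriv u (dirDeriv v f) x = fderiv ℝ (fderiv ℝ f) x u v := by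
  have h : DifferentiableAt ℝ (fderiv ℝ f) x :=
    (hf.fderiv_right (m := ∞) (by simp)).differentiable (by simp) x
  have h1 := h.hasFDerivAt.clm_apply (hasFDerivAt_const v x)
  unfold dirDeriv
  rw [h1.fderiv]
  simp

lemma dirDeriv_comm (hf : ContDiff ℝ ∞ f) (u v : E) :
    dirDeriv u (dirDeriv v f) = dirDeriv v (dirDeriv u f) := by
  ext x
  rw [dirDeriv_dirDeriv hf, dirDeriv_dirDeriv hf]
  exact ((contDiff_infty.1 hf 2).contDiffAt.isSymmSndFDerivAt (by simp)) u v

/-- The product rule for `⟨Ax, ∇⟩ f`. It is stated pointwise so that the direction `u` may later be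
chosen depending on `x`. -/
lemma dirDeriv_linDrift_apply (hf : ContDiff ℝ ∞ f) (A : E →L[ℝ] E) (u x : E) :
    dirDeriv u (linDrift A f) x = dirDeriv u (dirDeriv (A x) f) x + dirDeriv (A u) f x := by
  have h : DifferentiableAt ℝ (fderiv ℝ f) x :=
    (hf.fderiv_right (m := ∞) (by simp)).differentiable (by simp) x
  have h1 := h.hasFDerivAt.clm_apply (A.hasFDerivAt (x := x))
  rw [dirDeriv_dirDeriv hf]
  unfold dirDeriv linDrift
  rw [h1.fderiv]
  simp [add_comm]

lemma dirDeriv_linDrift (hf : ContDiff ℝ ∞ f) (A : E →L[ℝ] E) (u : E) :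
    dirDeriv u (linDrift A f) = fun x => linDrift A (dirDeriv u f) x + dirDeriv (A u) f x := by
  ext x
  rw [dirDeriv_linDrift_apply hf, dirDeriv_comm hf]
  rfl

lemma linDrift_linDrift (hf : ContDiff ℝ ∞ f) (A C : E →L[ℝ] E) (x : E) :
    linDrift A (linDrift C f) x =
      dirDeriv (A x) (dirDeriv (C x) f) x + dirDeriv (C (A x)) f x :=
  dirDeriv_linDrift_apply hf C (A x) x

lemma dirDeriv_dirDeriv_linDrift (hf : ContDiff ℝ ∞ f) (A : E →L[ℝ] E) (u x : E) :
    dirDeriv u (dirDeriv u (linDrift A f)) x =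
      linDrift A (dirDeriv u (dirDeriv u f)) x + (2 : ℝ) • dirDeriv (A u) (dirDeriv u f) x := by
  have h1 : dirDeriv u (dirDeriv u (linDrift A f)) x =
      dirDeriv u (linDrift A (dirDeriv u f)) x + dirDeriv u (dirDeriv (A u) f) x := by
    rw [dirDeriv_linDrift hf]
    exact congrArg (fun L => L u) (fderiv_fun_add
      ((contDiff_linDrift (contDiff_dirDeriv hf u) A).differentiable (by simp) x)
      ((contDiff_dirDeriv hf _).differentiable (by simp) x))
  rw [h1, dirDeriv_linDrift (contDiff_dirDeriv hf u), dirDeriv_comm hf u (A u)]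
  module

end Directional

variable {d : ℕ} {𝕜 : Type*} [RCLike 𝕜]

lemma laplacian_eq_sum_dirDeriv {f : EuclideanSpace ℝ (Fin d) → 𝕜} (hf : ContDiff ℝ ∞ f) :
    Δ f = fun x => ∑ i, dirDeriv (EuclideanSpace.basisFun (Fin d) ℝ i)
      (dirDeriv (EuclideanSpace.basisFun (Fin d) ℝ i) f) x := by
  rw [InnerProductSpace.laplacian_eq_iteratedFDeriv_orthonormalBasis f
    (EuclideanSpace.basisFun (Fin d) ℝ)]
  ext x
  refine Finset.sum_congr rfl fun i _ => ?_
  rw [iteratedFDeriv_two_apply, dirDeriv_dirDeriv hf]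
  rfl

lemma contDiff_laplacian {f : EuclideanSpace ℝ (Fin d) → 𝕜} (hf : ContDiff ℝ ∞ f) :
    ContDiff ℝ ∞ (Δ f) := by
  rw [laplacian_eq_sum_dirDeriv hf]
  exact ContDiff.sum fun i _ => contDiff_dirDeriv (contDiff_dirDeriv hf _) _

lemma laplacian_linDrift {f : EuclideanSpace ℝ (Fin d) → 𝕜} (hf : ContDiff ℝ ∞ f)
    (A : EuclideanSpace ℝ (Fin d) →L[ℝ] EuclideanSpace ℝ (Fin d)) (x : EuclideanSpace ℝ (Fin d)) :
    Δ (linDrift A f) x = linDrift A (Δ f) x + (2 : ℝ) •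
      ∑ i, dirDeriv (A (EuclideanSpace.basisFun (Fin d) ℝ i))
        (dirDeriv (EuclideanSpace.basisFun (Fin d) ℝ i) f) x := by
  have h1 : linDrift A (Δ f) x = ∑ i, linDrift A
      (dirDeriv (EuclideanSpace.basisFun (Fin d) ℝ i)
        (dirDeriv (EuclideanSpace.basisFun (Fin d) ℝ i) f)) x := by
    rw [laplacian_eq_sum_dirDeriv hf, linDrift, fderiv_fun_sum fun i _ =>
      (contDiff_dirDeriv (contDiff_dirDeriv hf _) _).differentiable (by simp) x]
    simp [linDrift]
  rw [laplacian_eq_sum_dirDeriv (contDiff_linDrift hf A), h1, Finset.smul_sum,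
    ← Finset.sum_add_distrib]
  exact Finset.sum_congr rfl fun i _ => dirDeriv_dirDeriv_linDrift hf A _ x

/-- The commutator `[L⁰, ℛ]`: a second order term with the entries of `R` as coefficients, and a
first order term given by the matrix commutator of `R` and `D_{1/λ}`. -/
lemma commutator_apply (lam : Fin d → ℝ) (R : Matrix (Fin d) (Fin d) ℝ)
    {f : EuclideanSpace ℝ (Fin d) → 𝕜} (hf : ContDiff ℝ ∞ f) (x : EuclideanSpace ℝ (Fin d)) :
    symmPart lam (antisymmPart R f) x - antisymmPart R (symmPart lam f) x =
      (∑ i, dirDeriv (Matrix.toEuclideanCLM (𝕜 := ℝ) R (EuclideanSpace.basisFun (Fin d) ℝ i))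
        (dirDeriv (EuclideanSpace.basisFun (Fin d) ℝ i) f) x) -
      (1 / 2 : ℝ) • dirDeriv (Matrix.toEuclideanCLM (𝕜 := ℝ)
        (R * (Matrix.diagonal fun i => 1 / lam i) - (Matrix.diagonal fun i => 1 / lam i) * R) x)
        f x := by
  set A := Matrix.toEuclideanCLM (𝕜 := ℝ) R with hA
  set C := Matrix.toEuclideanCLM (𝕜 := ℝ) (Matrix.diagonal fun i => 1 / lam i) with hC
  have h1 : antisymmPart R (symmPart lam f) x =
      (1 / 2 : ℝ) • linDrift A (Δ f) x - (1 / 2 : ℝ) • linDrift A (linDrift C f) x := by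
    have hΔ := (contDiff_laplacian hf).differentiable (by simp) x
    have hd := (contDiff_linDrift hf C).differentiable (by simp) x
    have h2 : HasFDerivAt (symmPart lam f) ((1 / 2 : ℝ) • fderiv ℝ (Δ f) x -
      (1 / 2 : ℝ) • fderiv ℝ (linDrift C f) x) x :=
      (hΔ.hasFDerivAt.const_smul (1 / 2 : ℝ)).sub (hd.hasFDerivAt.const_smul (1 / 2 : ℝ))
    rw [antisymmPart, drift, h2.fderiv]
    rfl
  have h2 : symmPart lam (antisymmPart R f) x =
      (1 / 2 : ℝ) • Δ (linDrift A f) x - (1 / 2 : ℝ) • linDrift C (linDrift A f) x := rfl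
  have h3 : dirDeriv (Matrix.toEuclideanCLM (𝕜 := ℝ)
        (R * (Matrix.diagonal fun i => 1 / lam i) - (Matrix.diagonal fun i => 1 / lam i) * R) x)
        f x = dirDeriv (A (C x)) f x - dirDeriv (C (A x)) f x := by
    rw [map_sub, map_mul, map_mul, ← hA, ← hC]
    exact map_sub (fderiv ℝ f x) _ _
  rw [h1, h2, h3, laplacian_linDrift hf, linDrift_linDrift hf, linDrift_linDrift hf,
    dirDeriv_comm hf (C x) (A x)]
  module

lemma toEuclideanCLM_basisFun_apply (R : Matrix (Fin d) (Fin d) ℝ) (i j : Fin d) :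
    Matrix.toEuclideanCLM (𝕜 := ℝ) R (EuclideanSpace.basisFun (Fin d) ℝ i) j = R j i := by
  simp [Matrix.ofLp_toEuclideanCLM]

/-- The second order term of the commutator vanishes when `R` is antisymmetric. -/
lemma sum_dirDeriv_eq_zero {R : Matrix (Fin d) (Fin d) ℝ} (hR : R + Rᵀ = 0)
    {f : EuclideanSpace ℝ (Fin d) → 𝕜} (hf : ContDiff ℝ ∞ f) (x : EuclideanSpace ℝ (Fin d)) :
    ∑ i, dirDeriv (Matrix.toEuclideanCLM (𝕜 := ℝ) R (EuclideanSpace.basisFun (Fin d) ℝ i))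
        (dirDeriv (EuclideanSpace.basisFun (Fin d) ℝ i) f) x = 0 := by
  set e := EuclideanSpace.basisFun (Fin d) ℝ with he
  have h1 : ∀ i, Matrix.toEuclideanCLM (𝕜 := ℝ) R (e i) = ∑ j, R j i • e j := by
    intro i
    rw [← e.sum_repr (Matrix.toEuclideanCLM (𝕜 := ℝ) R (e i))]
    refine Finset.sum_congr rfl fun j _ => ?_
    rw [he, EuclideanSpace.basisFun_repr, toEuclideanCLM_basisFun_apply]
  set H : Fin d → Fin d → 𝕜 := fun j i => dirDeriv (e j) (dirDeriv (e i) f) x with hH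
  have h2 : ∀ i, dirDeriv (Matrix.toEuclideanCLM (𝕜 := ℝ) R (e i)) (dirDeriv (e i) f) x =
      ∑ j, R j i • H j i := by
    intro i
    rw [h1, dirDeriv, map_sum]
    simp only [map_smul]
    rfl
  simp only [h2]
  have h3 : ∑ i, ∑ j, R j i • H j i = -∑ i, ∑ j, R j i • H j i := by
    conv_lhs => rw [Finset.sum_comm]
    simp only [← Finset.sum_neg_distrib]
    refine Finset.sum_congr rfl fun i _ => Finset.sum_congr rfl fun j _ => ?_
    have hs : H i j = H j i := congrFun (dirDeriv_comm hf _ _) x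
    have hr : R i j = -R j i := by
      have := congrFun₂ hR i j
      simp only [Matrix.add_apply, Matrix.transpose_apply, Matrix.zero_apply] at this
      linarith
    rw [hs, hr, neg_smul]
  exact self_eq_neg.1 h3

lemma hasFDerivAt_coord_mul_coord (p q : Fin d) (x : EuclideanSpace ℝ (Fin d)) :
    HasFDerivAt (fun x : EuclideanSpace ℝ (Fin d) => ((x p * x q : ℝ) : 𝕜))
      ((RCLike.ofRealCLM (K := 𝕜)).comp
        (x p • (EuclideanSpace.proj q : EuclideanSpace ℝ (Fin d) →L[ℝ] ℝ) +
          x q • (EuclideanSpace.proj p : EuclideanSpace ℝ (Fin d) →L[ℝ] ℝ))) x :=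
  (RCLike.ofRealCLM (K := 𝕜)).hasFDerivAt.comp x
    ((EuclideanSpace.proj p : EuclideanSpace ℝ (Fin d) →L[ℝ] ℝ).hasFDerivAt.mul
      (EuclideanSpace.proj q : EuclideanSpace ℝ (Fin d) →L[ℝ] ℝ).hasFDerivAt)

lemma dirDeriv_dirDeriv_coord_mul_coord (p q : Fin d) (u v x : EuclideanSpace ℝ (Fin d)) :
    dirDeriv u (dirDeriv v fun x : EuclideanSpace ℝ (Fin d) => ((x p * x q : ℝ) : 𝕜)) x =
      ((u p * v q + u q * v p : ℝ) : 𝕜) := by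
  have h1 : (dirDeriv v fun x : EuclideanSpace ℝ (Fin d) => ((x p * x q : ℝ) : 𝕜)) =
      (RCLike.ofRealCLM (K := 𝕜)).comp
        (v q • (EuclideanSpace.proj p : EuclideanSpace ℝ (Fin d) →L[ℝ] ℝ) +
          v p • (EuclideanSpace.proj q : EuclideanSpace ℝ (Fin d) →L[ℝ] ℝ)) := by
    ext x
    rw [dirDeriv, (hasFDerivAt_coord_mul_coord p q x).fderiv]
    simp [mul_comm]
  rw [h1, dirDeriv, ContinuousLinearMap.fderiv]
  simp [mul_comm]

lemma dirDeriv_congr {E F : Type*} [NormedAddCommGroup E] [NormedSpace ℝ E]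
    [NormedAddCommGroup F] [NormedSpace ℝ F] {f g : E → F} {x : E} (h : f =ᶠ[nhds x] g) (v : E) :
    dirDeriv v f =ᶠ[nhds x] dirDeriv v g := by
  filter_upwards [h.fderiv (𝕜 := ℝ)] with y hy
  rw [dirDeriv, dirDeriv, hy]

/-- There is a Schwartz function that agrees with `x_p x_q` near the origin. -/
lemma exists_schwartz_eq_coord_mul_coord (p q : Fin d) :
    ∃ φ : 𝓢(EuclideanSpace ℝ (Fin d), 𝕜), ⇑φ =ᶠ[nhds 0] fun x => ((x p * x q : ℝ) : 𝕜) := by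
  let χ : ContDiffBump (0 : EuclideanSpace ℝ (Fin d)) := ⟨1, 2, one_pos, one_lt_two⟩
  have hquad : ContDiff ℝ ∞ fun x : EuclideanSpace ℝ (Fin d) => ((x p * x q : ℝ) : 𝕜) :=
    (RCLike.ofRealCLM (K := 𝕜)).contDiff.comp
      ((EuclideanSpace.proj p : EuclideanSpace ℝ (Fin d) →L[ℝ] ℝ).contDiff.mul
        (EuclideanSpace.proj q : EuclideanSpace ℝ (Fin d) →L[ℝ] ℝ).contDiff)
  have hs : HasCompactSupport fun x : EuclideanSpace ℝ (Fin d) =>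
      χ x • ((x p * x q : ℝ) : 𝕜) := χ.hasCompactSupport.smul_right
  refine ⟨hs.toSchwartzMap (χ.contDiff.smul hquad), ?_⟩
  filter_upwards [χ.eventuallyEq_one] with x hx
  simp [hx]

/-- The operators `L⁰` and `ℛ` commute on Schwartz functions if and only if `R` is antisymmetric,
provided that antisymmetry makes `R` commute with `D_λ`, which the Lyapunov equation guarantees.
The forward direction evaluates the commutator at the origin on functions with prescribed Hessian
there. -/
lemma commutator_eq_zero_iff (lam : Fin d → ℝ) (hlam : ∀ i, 0 < lam i)
    {R : Matrix (Fin d) (Fin d) ℝ} (hcomm : R + Rᵀ = 0 → Commute (Matrix.diagonal lam) R) :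
    (∀ φ : 𝓢(EuclideanSpace ℝ (Fin d), 𝕜), ∀ x : EuclideanSpace ℝ (Fin d),
      symmPart lam (antisymmPart R ⇑φ) x - antisymmPart R (symmPart lam ⇑φ) x = 0) ↔
      R + Rᵀ = 0 := by
  constructor
  · intro h
    ext p q
    obtain ⟨φ, hφ⟩ := exists_schwartz_eq_coord_mul_coord (𝕜 := 𝕜) p q
    have h1 := h φ 0
    have h2 : ∀ u v, dirDeriv u (dirDeriv v φ) 0 = ((u p * v q + u q * v p : ℝ) : 𝕜) := by
      intro u v
      rw [(dirDeriv_congr (dirDeriv_congr hφ v) u).self_of_nhds,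
        dirDeriv_dirDeriv_coord_mul_coord]
    rw [commutator_apply lam R (φ.smooth ⊤)] at h1
    simp only [h2, toEuclideanCLM_basisFun_apply, map_zero] at h1
    have h3 : ∀ i j, EuclideanSpace.basisFun (Fin d) ℝ i j = if j = i then 1 else 0 := by
      intro i j
      simp
    have h4 : dirDeriv (0 : EuclideanSpace ℝ (Fin d)) (⇑φ) 0 = 0 := by
      rw [dirDeriv, map_zero]
    rw [h4, smul_zero, sub_zero, ← RCLike.ofReal_sum, RCLike.ofReal_eq_zero] at h1
    simpa [h3, Finset.sum_add_distrib] using h1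
  · intro h φ x
    have hRE : R * (Matrix.diagonal fun i => 1 / lam i) =
        (Matrix.diagonal fun i => 1 / lam i) * R := by
      have hDE := diagonal_mul_diagonal_one_div hlam
      have hED := mul_eq_one_comm.1 hDE
      have hc := (hcomm h).eq
      generalize Matrix.diagonal lam = D at *
      generalize (Matrix.diagonal fun i => 1 / lam i) = E at *
      calc R * E = (E * D) * R * E := by rw [hED, one_mul]
        _ = E * R * (D * E) := by rw [mul_assoc E, hc]; simp only [mul_assoc]
        _ = E * R := by rw [hDE, mul_one]
    rw [commutator_apply lam R (φ.smooth ⊤), sum_dirDeriv_eq_zero h (φ.smooth ⊤), hRE, sub_self,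
      map_zero]
    simp [dirDeriv]

end Commutator

/-! ### Normality of the Ornstein–Uhlenbeck semigroup -/

section Normal

variable {d : ℕ}

lemma hasGaussianMGF_multivariateGaussian {S : Matrix (Fin d) (Fin d) ℝ} (hS : S.PosSemidef) :
    HasGaussianMGF (multivariateGaussian 0 S) (Matrix.toEuclideanCLM (𝕜 := ℝ) S) := by
  intro ξ
  set γ := multivariateGaussian 0 S
  have hmap : γ.map (fun x => ⟪ξ, x⟫_ℝ) =
      gaussianReal 0 (⟪ξ, Matrix.toEuclideanCLM (𝕜 := ℝ) S ξ⟫_ℝ).toNNReal := by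
    have h := IsGaussian.map_eq_gaussianReal (μ := γ) (innerSL ℝ ξ)
    have hmean : ∫ x, innerSL ℝ ξ x ∂γ = 0 := by
      rw [(innerSL ℝ ξ).integral_comp_id_comm IsGaussian.integrable_id,
        integral_id_multivariateGaussian, map_zero]
    have hvar : Var[innerSL ℝ ξ; γ] = ⟪ξ, Matrix.toEuclideanCLM (𝕜 := ℝ) S ξ⟫_ℝ := by
      rw [Matrix.inner_toEuclideanCLM, ← covarianceBilin_multivariateGaussian (μ := 0) hS,
        covarianceBilin_self IsGaussian.memLp_two_id]
      rfl
    rw [hmean, hvar] at h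
    exact h
  have hnonneg : 0 ≤ ⟪ξ, Matrix.toEuclideanCLM (𝕜 := ℝ) S ξ⟫_ℝ := by
    rw [Matrix.inner_toEuclideanCLM]
    exact hS.dotProduct_mulVec_nonneg ξ
  constructor
  · have h := integrable_exp_mul_gaussianReal (μ := 0)
      (v := (⟪ξ, Matrix.toEuclideanCLM (𝕜 := ℝ) S ξ⟫_ℝ).toNNReal) 1
    rw [← hmap, integrable_map_measure (by fun_prop) (by fun_prop)] at h
    simpa [Function.comp_def] using h
  · have h := mgf_gaussianReal hmap 1
    rw [Real.coe_toNNReal _ hnonneg] at h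
    simpa [mgf] using h

/-- If `P = N + C P C*`, the image of `N(0, P) × N(0, N)` under `(x, y) ↦ C x - y` is `N(0, P)`. -/
lemma measurePreserving_sub {P N C : Matrix (Fin d) (Fin d) ℝ} (hP : P.PosSemidef)
    (hN : N.PosSemidef) (hPN : P = N + C * P * Cᵀ) :
    MeasurePreserving (fun z : EuclideanSpace ℝ (Fin d) × EuclideanSpace ℝ (Fin d) =>
        Matrix.toEuclideanCLM (𝕜 := ℝ) C z.1 - z.2)
      ((multivariateGaussian 0 P).prod (multivariateGaussian 0 N)) (multivariateGaussian 0 P) := by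
  refine ⟨by fun_prop, Measure.ext_of_charFun (funext fun ξ => ?_)⟩
  set ζ := Matrix.toEuclideanCLM (𝕜 := ℝ) Cᵀ ξ with hζ
  have h1 : ∀ z : EuclideanSpace ℝ (Fin d) × EuclideanSpace ℝ (Fin d),
      Complex.exp (⟪Matrix.toEuclideanCLM (𝕜 := ℝ) C z.1 - z.2, ξ⟫_ℝ * Complex.I) =
        Complex.exp (⟪z.1, ζ⟫_ℝ * Complex.I) * Complex.exp (⟪z.2, -ξ⟫_ℝ * Complex.I) := by
    intro z
    have h2 : ⟪Matrix.toEuclideanCLM (𝕜 := ℝ) C z.1, ξ⟫_ℝ = ⟪z.1, ζ⟫_ℝ := by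
      rw [real_inner_comm, Matrix.inner_toEuclideanCLM, hζ, Matrix.inner_toEuclideanCLM,
        Matrix.dotProduct_mulVec, Matrix.mulVec_transpose, dotProduct_comm]
    rw [inner_sub_left, h2, inner_neg_right, ← Complex.exp_add]
    push_cast
    ring_nf
  rw [charFun_apply, integral_map (by fun_prop) (by fun_prop)]
  simp only [h1]
  rw [integral_prod_mul (fun x => Complex.exp (⟪x, ζ⟫_ℝ * Complex.I))
    (fun y => Complex.exp (⟪y, -ξ⟫_ℝ * Complex.I)), ← charFun_apply, ← charFun_apply,
    charFun_multivariateGaussian hP, charFun_multivariateGaussian hP,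
    charFun_multivariateGaussian hN, ← Complex.exp_add]
  have h3 : ξ.ofLp ⬝ᵥ P *ᵥ ξ.ofLp =
      ξ.ofLp ⬝ᵥ N *ᵥ ξ.ofLp + ζ.ofLp ⬝ᵥ P *ᵥ ζ.ofLp := by
    conv_lhs => rw [hPN]
    rw [Matrix.add_mulVec, dotProduct_add, hζ, Matrix.ofLp_toEuclideanCLM,
      ← Matrix.mulVec_mulVec, ← Matrix.mulVec_mulVec, Matrix.dotProduct_mulVec _ C,
      Matrix.mulVec_transpose]
  rw [h3]
  simp only [inner_zero_right, WithLp.ofLp_neg, Matrix.mulVec_neg, dotProduct_neg, neg_dotProduct]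
  push_cast
  ring_nf

/-- Normality of the semigroup, time by time, as a commutation relation of matrices. -/
lemma isNormalSemigroup_iff (𝕜 : Type*) [RCLike 𝕜] {Q B : Matrix (Fin d) (Fin d) ℝ}
    (hQ : Q.PosSemidef) (hB : ∀ μ ∈ spectrum ℂ (B.map (algebraMap ℝ ℂ)), μ.re < 0)
    (hP : (covQInf Q B).PosDef) :
    IsNormalSemigroup 𝕜 Q B ↔
      ∀ t : ℝ, 0 ≤ t → Commute (expMat Bᵀ t) (expMat ((covQInf Q B)⁻¹ * B * covQInf Q B) t) := by
  refine forall₂_congr fun t ht => ?_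
  set P := covQInf Q B with hPdef
  have hPN := covQInf_eq_covQ_add Q hB ht
  rw [← hPdef] at hPN
  have hN := posSemidef_covQ B hQ t
  have hPu : IsUnit P := hP.isUnit
  have hPdet : IsUnit P.det := (Matrix.isUnit_iff_isUnit_det _).1 hPu
  set C := expMat B t with hC
  have hS := measurePreserving_sub hP.posSemidef hN hPN
  have hadj : ∀ A : Matrix (Fin d) (Fin d) ℝ,
      ContinuousLinearMap.adjoint (Matrix.toEuclideanCLM (𝕜 := ℝ) A) =
        Matrix.toEuclideanCLM (𝕜 := ℝ) Aᵀ := fun A => by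
    rw [← ContinuousLinearMap.star_eq_adjoint, ← map_star, Matrix.star_eq_conjTranspose,
      Matrix.conjTranspose_eq_transpose_of_trivial]
  have hmul : ∀ (A D : Matrix (Fin d) (Fin d) ℝ) (x : EuclideanSpace ℝ (Fin d)),
      Matrix.toEuclideanCLM (𝕜 := ℝ) A (Matrix.toEuclideanCLM (𝕜 := ℝ) D x) =
        Matrix.toEuclideanCLM (𝕜 := ℝ) (A * D) x := fun A D x => by
    rw [map_mul]; rfl
  have hsymm : ∀ ξ η, ⟪Matrix.toEuclideanCLM (𝕜 := ℝ) P ξ, η⟫_ℝ =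
      ⟪ξ, Matrix.toEuclideanCLM (𝕜 := ℝ) P η⟫_ℝ := fun ξ η => by
    have hPt : Pᵀ = P := by
      rw [← Matrix.conjTranspose_eq_transpose_of_trivial]; exact hP.isHermitian
    rw [← ContinuousLinearMap.adjoint_inner_right, hadj, hPt]
  have hinj : Function.Injective (Matrix.toEuclideanCLM (𝕜 := ℝ) P) := by
    refine Function.LeftInverse.injective (g := Matrix.toEuclideanCLM (𝕜 := ℝ) P⁻¹) fun x => ?_
    rw [hmul, Matrix.nonsing_inv_mul _ hPdet, map_one]
    rfl
  have hcov : ∀ ξ, Matrix.toEuclideanCLM (𝕜 := ℝ) P ξ =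
      Matrix.toEuclideanCLM (𝕜 := ℝ) (covQ Q B t) ξ + Matrix.toEuclideanCLM (𝕜 := ℝ) C
        (Matrix.toEuclideanCLM (𝕜 := ℝ) P (ContinuousLinearMap.adjoint
          (Matrix.toEuclideanCLM (𝕜 := ℝ) C) ξ)) := fun ξ => by
    rw [hadj, hmul, hmul]
    conv_lhs => rw [hPN, map_add]
    rfl
  have hK : ∀ ξ, Matrix.toEuclideanCLM (𝕜 := ℝ) P
      (Matrix.toEuclideanCLM (𝕜 := ℝ) (P⁻¹ * C * P) ξ) =
        Matrix.toEuclideanCLM (𝕜 := ℝ) C (Matrix.toEuclideanCLM (𝕜 := ℝ) P ξ) := fun ξ => by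
    rw [hmul, hmul, mul_assoc P⁻¹, ← mul_assoc P, Matrix.mul_nonsing_inv _ hPdet, one_mul]
  have hnormal := transitionOp_normal_iff (𝕜 := 𝕜)
    (hasGaussianMGF_multivariateGaussian hP.posSemidef)
    (hasGaussianMGF_multivariateGaussian hN) hsymm hinj hcov hS hK
  have hcomm : Commute (ContinuousLinearMap.adjoint (Matrix.toEuclideanCLM (𝕜 := ℝ) C))
      (Matrix.toEuclideanCLM (𝕜 := ℝ) (P⁻¹ * C * P)) ↔
      Commute (expMat Bᵀ t) (expMat (P⁻¹ * B * P) t) := by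
    rw [hadj, expMat_conj hPu, expMat_transpose, commute_iff_eq, commute_iff_eq, ← map_mul,
      ← map_mul]
    exact (Matrix.toEuclideanCLM (𝕜 := ℝ)).injective.eq_iff
  rw [← hcomm, ← hnormal]
  constructor
  · rintro ⟨T, hT, hTn⟩
    -- The Ornstein–Uhlenbeck formula determines the operator.
    have hTeq : T = transitionOp 𝕜 hS := ContinuousLinearMap.ext fun f =>
      Lp.ext ((hT f).trans (transitionOp_ae_eq hS f).symm)
    rwa [← hTeq]
  · intro h
    exact ⟨transitionOp 𝕜 hS, fun f => transitionOp_ae_eq hS f, h⟩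

end Normal

end OrnsteinUhlenbeck

theorem proposition2p1 {𝕜 : Type*} [RCLike 𝕜] {d : ℕ}
    (Q B : Matrix (Fin d) (Fin d) ℝ) (hQ : Q.PosDef)
    (hB : ∀ μ ∈ spectrum ℂ (B.map (algebraMap ℝ ℂ)), μ.re < 0)
    (M₁ M₂ : Matrix (Fin d) (Fin d) ℝ) (lam : Fin d → ℝ)
    (hM₁ : M₁ * Q * M₁ᵀ = 1) (hM₂ : M₂ ∈ Matrix.orthogonalGroup (Fin d) ℝ)
    (hlam : ∀ i, 0 < lam i)
    (hD : M₂ * M₁ * OrnsteinUhlenbeck.covQInf Q B * M₁ᵀ * M₂ᵀ = Matrix.diagonal lam)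
    (R : Matrix (Fin d) (Fin d) ℝ)
    (hR : (M₂ * M₁) * B * (M₂ * M₁)⁻¹ =
      -((1 / 2 : ℝ) • Matrix.diagonal fun i => 1 / lam i) + R) :
    List.TFAE [
      OrnsteinUhlenbeck.IsNormalSemigroup 𝕜 Q B,
      ∀ φ : 𝓢(EuclideanSpace ℝ (Fin d), 𝕜), ∀ x : EuclideanSpace ℝ (Fin d),
        OrnsteinUhlenbeck.symmPart lam (OrnsteinUhlenbeck.antisymmPart R ⇑φ) x -
          OrnsteinUhlenbeck.antisymmPart R (OrnsteinUhlenbeck.symmPart lam ⇑φ) x = 0,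
      R + Rᵀ = 0,
      Commute (Matrix.diagonal lam) R] := by
  set M := M₂ * M₁ with hM
  have hMQ : M * Q * Mᵀ = 1 := by
    rw [hM, Matrix.transpose_mul]
    calc M₂ * M₁ * Q * (M₁ᵀ * M₂ᵀ) = M₂ * (M₁ * Q * M₁ᵀ) * M₂ᵀ := by simp only [mul_assoc]
      _ = 1 := by rw [hM₁, mul_one]; exact (Matrix.mem_orthogonalGroup_iff _ _).1 hM₂
  have hMD : M * OrnsteinUhlenbeck.covQInf Q B * Mᵀ = Matrix.diagonal lam := by
    rw [← hD, hM, Matrix.transpose_mul, ← mul_assoc]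
  have hMu : IsUnit M := (Matrix.isUnit_iff_isUnit_det _).2
    (Matrix.isUnit_det_of_right_inverse (B := Q * Mᵀ) (by rw [← mul_assoc, hMQ]))
  have hP : (OrnsteinUhlenbeck.covQInf Q B).PosDef := by
    rw [← Matrix.IsUnit.posDef_star_right_conjugate_iff hMu, Matrix.star_eq_conjTranspose,
      Matrix.conjTranspose_eq_transpose_of_trivial, hMD]
    exact Matrix.PosDef.diagonal hlam
  have hRD := OrnsteinUhlenbeck.mul_diagonal_add_diagonal_mul_transpose hlam hMQ
    (OrnsteinUhlenbeck.lyapunov Q hB) hMD hR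
  have h34 := OrnsteinUhlenbeck.add_transpose_eq_zero_iff_commute hlam hRD
  have h14 := (OrnsteinUhlenbeck.isNormalSemigroup_iff 𝕜 hQ.posSemidef hB hP).trans
    ((OrnsteinUhlenbeck.forall_commute_expMat_iff _ _).trans
      (OrnsteinUhlenbeck.commute_transpose_conj_iff hlam hMu hMD hR hRD))
  have h23 := OrnsteinUhlenbeck.commutator_eq_zero_iff (𝕜 := 𝕜) lam hlam h34.1
  tfae_have 1 ↔ 4 := h14
  tfae_have 2 ↔ 3 := h23
  tfae_have 3 ↔ 4 := h34
  tfae_finish
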